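/- Let $\lambda\in\mathbb N$ be the security parameter. For each $\lambda$ let $n=n(\lambda)$ be a number of qubits, bounded by a polynomial in $\lambda$ and such that $1/d$ is negligible in $\lambda$, where $d=d(\lambda)=2^{n(\lambda)}$. Let $\mathcal K_\lambda$ be a finite non-empty set of keys (bit strings) and, for $k\in\mathcal K_\lambda$, let $U_k$ be a unitary operator on the $n$-qubit space $\mathcal H=(\mathbb C^2)^{\otimes n}\cong\mathbb C^{d}$. Write $k\leftarrow\mathcal K_\lambda$ for a uniformly random key, and $\mu$ for the Haar probability measure on the unitary group of $\mathcal H$ as well as for the induced (uniform) probability measure on its pure states. A function $f:\mathbb N\to\mathbb R$ is negligible if $\lambda^c f(\lambda)\to 0$ for every $c\in\mathbb N$. A quantum polynomial-time (QPT) algorithm is a uniform family of quantum circuits over the gates Hadamard, $T$, controlled-not and Toffoli (and oracle gates, for oracle algorithms), with ancilla qubits initialised to $|0\rangle$, which is written out by one classical program in time polynomial in $\lambda$ on input $1^\lambda$ and $1^{n(\lambda)}$ (and on the key, if it has one as input). The family $\{U_k\}_{k\in\mathcal K_\lambda}$ is a *family of pseudorandom unitaries* (PRU) if 1. (efficient computation)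 the keys have length polynomial in $\lambda$, and there is a QPT algorithm $Q$ such that, for all $k$ and all pure states $|\psi\rangle$, $Q(k,|\psi\rangle)=U_k|\psi\rangle$, where an error in the fidelity is allowed that is bounded by a negligible function of $\lambda$ independent of $k$ and $|\psi\rangle$; 2. (pseudorandomness) for every QPT algorithm $\mathcal A$ with oracle access, $$\Big|\Pr_{k\leftarrow\mathcal K_\lambda}\big[\mathcal A^{U_k}(1^\lambda)=1\big]-\Pr_{U\leftarrow\mu}\big[\mathcal A^{U}(1^\lambda)=1\big]\Big|$$ is negligible in $\lambda$. The family is a *family of unknown unitaries* (UU) if for every QPT algorithm $\mathcal A$ without oracle access, which maps an $n$-qubit state to a (mixed) $n$-qubit state, and for every threshold $\delta:\mathbb N\to\mathbb R$ that is at least an inverse polynomial (there is a $c$ with $\delta(\lambda)\ge\lambda^{-c}$ for all sufficiently large $\lambda$), the difference $$\Big|\Pr_{k\leftarrow\mathcal K_\lambda,\ |\psi\rangle\leftarrow\mu}\big[F(\mathcal A(|\psi\rangle),U_k|\psi\rangle)\ge\delta(\lambda)\big]-\Pr_{U\leftarrow\mu,\ |\psi\rangle\leftarrow\mu}\big[F(\mathcal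 A(|\psi\rangle),U|\psi\rangle)\ge\delta(\lambda)\big]\Big|$$ is negligible in $\lambda$. Here $F(\rho,|\varphi\rangle)=\sqrt{\langle\varphi|\rho|\varphi\rangle}$ is the Uhlmann fidelity. **Theorem.** Every family of pseudorandom unitaries is a family of unknown unitaries. -/

import Mathlib

open scoped Matrix
open Filter MeasureTheory

noncomputable section

namespace QPT

/-! ### Wires, gates and circuits -/

/-- Qubits (wires) are organised in named arrays; a wire is the name of its array and its address
in the array.  All but finitely many wires stay in the state `0` during a computation. -/
abbrev Wire := ℕ × List Bool

/-- The labels of the computational basis of an `n`-qubit space. -/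
abbrev Bits (n : ℕ) := Fin n → Bool

/-- The group of unitary operators of an `n`-qubit space (dimension `2 ^ n`). -/
abbrev UGroup (n : ℕ) := ↥(Matrix.unitaryGroup (Bits n) ℂ)

/-- The gate set: Hadamard, `T`, controlled-not, Toffoli, and a query to the oracle, applied to
the `n` qubits of the register in the named array. `A` is the type of addresses of single wires. -/
inductive GateOn (A : Type) : Type
  | had (q : A)
  | tgate (q : A)
  | cnot (c t : A)
  | ccnot (c₁ c₂ t : A)
  | oracle (r : ℕ)

namespace GateOn

/-- Replace the addresses of a gate. -/
def map {A B : Type} (f : A → B) : GateOn A → GateOn B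
  | had q => had (f q)
  | tgate q => tgate (f q)
  | cnot c t => cnot (f c) (f t)
  | ccnot c₁ c₂ t => ccnot (f c₁) (f c₂) (f t)
  | oracle r => oracle r

end GateOn

abbrev Gate := GateOn Wire

/-- A circuit is a list of gates; the head is applied first. -/
abbrev Circuit := List Gate

/-- The circuit makes no oracle query. -/
def OracleFree (C : Circuit) : Prop := ∀ r : ℕ, GateOn.oracle r ∉ C

/-- A computational basis state of all wires: the finite set of wires whose value is `1`. -/
abbrev Config := Finset Wire

/-- (Unnormalised) pure states, as finite superpositions of computational basis states. -/
abbrev State := Config →₀ ℂ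

/-- The `i`-th qubit of the register in array `r`. -/
def regWire (r : ℕ) {n : ℕ} (i : Fin n) : Wire := (r, List.replicate i true)

/-- All `n` wires of the register in array `r`. -/
def regWires (n r : ℕ) : Config := Finset.univ.image (fun i : Fin n => regWire r i)

/-- The basis state in which the register in array `r` holds `x` and all other wires are `0`. -/
def regConfig {n : ℕ} (r : ℕ) (x : Bits n) : Config :=
  (Finset.univ.filter (fun i : Fin n => x i = true)).image (fun i => regWire r i)

/-- The contents of the register in array `r`. -/
def readReg (n r : ℕ) (s : Config) : Bits n := fun i => decide (regWire r i ∈ s)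

/-- Overwrite the contents of the register in array `r`. -/
def writeReg {n : ℕ} (r : ℕ) (y : Bits n) (s : Config) : Config :=
  (s \ regWires n r) ∪ regConfig r y

/-- Negate the value of the wire `q`. -/
def flipWire (q : Wire) (s : Config) : Config := symmDiff s {q}

/-- The action of a gate on a computational basis state, with oracle `U`.  A controlled gate whose
target is also one of its controls acts as the identity. -/
def gateBasis {n : ℕ} (U : UGroup n) : Gate → Config → State
  | .had q, s => ((Real.sqrt 2 : ℝ) : ℂ)⁻¹ •
      (Finsupp.single (s.erase q) 1 + (if q ∈ s then -1 else 1 : ℂ) • Finsupp.single (insert q s) 1)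
  | .tgate q, s =>
      Finsupp.single s (if q ∈ s then Complex.exp (Complex.I * (Real.pi / 4 : ℝ)) else 1)
  | .cnot c t, s =>
      Finsupp.single (if c ∈ s ∧ c ≠ t then flipWire t s else s) 1
  | .ccnot c₁ c₂ t, s =>
      Finsupp.single (if c₁ ∈ s ∧ c₂ ∈ s ∧ c₁ ≠ t ∧ c₂ ≠ t then flipWire t s else s) 1
  | .oracle r, s =>
      ∑ y : Bits n, (U : Matrix (Bits n) (Bits n) ℂ) y (readReg n r s) •
        Finsupp.single (writeReg r y s) 1

/-- The linear action of a gate. -/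
def applyGate {n : ℕ} (U : UGroup n) (g : Gate) : State →ₗ[ℂ] State :=
  Finsupp.linearCombination ℂ (gateBasis U g)

/-- Run a circuit with oracle `U` on an initial state. -/
def runCircuit {n : ℕ} (U : UGroup n) (C : Circuit) (χ : State) : State :=
  C.foldl (fun χ' g => applyGate U g χ') χ

/-- The probability that measuring the output wire `(0, [])` gives `1`, when the circuit is run
with oracle `U` and all wires start in the state `0`. -/
def acceptProb {n : ℕ} (U : UGroup n) (C : Circuit) : ℝ :=
  ∑ s ∈ (runCircuit U C (Finsupp.single ∅ 1)).support.filter (fun s => ((0, []) : Wire) ∈ s),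
    ‖runCircuit U C (Finsupp.single ∅ 1) s‖ ^ 2

/-- The `n`-qubit state `φ` in the register of array `0`, all other wires `0`. -/
def inputState {n : ℕ} (φ : Bits n → ℂ) : State :=
  ∑ x : Bits n, φ x • Finsupp.single (regConfig 0 x) 1

/-- The output of an oracle-free circuit on the `n`-qubit input state `φ`: the reduced density
matrix of the register in array `0`, all other wires being traced out. (The circuit is run
with the identity in place of the oracle, which is irrelevant if it is oracle-free.) -/
def outputState {n : ℕ} (C : Circuit) (φ : Bits n → ℂ) : Matrix (Bits n) (Bits n) ℂ :=
  fun y z =>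
    ∑ s ∈ (runCircuit (1 : UGroup n) C (inputState φ)).support.filter
        (fun s => readReg n 0 s = y),
      runCircuit (1 : UGroup n) C (inputState φ) s *
        star (runCircuit (1 : UGroup n) C (inputState φ) (writeReg 0 z s))

/-- The Uhlmann fidelity `F(ρ, |φ⟩⟨φ|) = √⟨φ|ρ|φ⟩` of a density matrix with a pure state. -/
def fidelity {n : ℕ} (ρ : Matrix (Bits n) (Bits n) ℂ) (φ : Bits n → ℂ) : ℝ :=
  Real.sqrt (star φ ⬝ᵥ (ρ *ᵥ φ)).re

/-! ### Classical programs that generate circuits -/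

/-- The memory of a classical program: countably many stacks of bits. -/
abbrev Store := ℕ → List Bool

/-- Programs of a multi-stack machine with structured control, which write out a list of gates.
In `emit g`, a wire is given by the name of an array and the name of a stack whose present
contents are the address. -/
inductive Prog : Type
  | skip
  | push (r : ℕ) (b : Bool)
  | pop (r : ℕ)
  | emit (g : GateOn (ℕ × ℕ))
  | seq (p q : Prog)
  | branch (r : ℕ) (ifTrue ifFalse ifEmpty : Prog)
  | loop (r : ℕ) (body : Prog)

/-- `Exec p s s' C t`: started with memory `s`, the program `p` halts after `t` steps with
memory `s'`, having written out the circuit `C`.  `branch` looks at the top of a stack; `loop r`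
repeats its body as long as the stack `r` is not empty. -/
inductive Exec : Prog → Store → Store → Circuit → ℕ → Prop
  | skip (s : Store) : Exec .skip s s [] 1
  | push (r : ℕ) (b : Bool) (s : Store) :
      Exec (.push r b) s (Function.update s r (b :: s r)) [] 1
  | pop (r : ℕ) (s : Store) :
      Exec (.pop r) s (Function.update s r (s r).tail) [] 1
  | emit (g : GateOn (ℕ × ℕ)) (s : Store) :
      Exec (.emit g) s s [g.map (fun w => (w.1, s w.2))] 1
  | seq {p q : Prog} {s s' s'' : Store} {C D : Circuit} {t u : ℕ} :
      Exec p s s' C t → Exec q s' s'' D u → Exec (.seq p q) s s'' (C ++ D) (t + u)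
  | branchTrue {r : ℕ} {p q e : Prog} {s s' : Store} {C : Circuit} {t : ℕ} :
      (s r).head? = some true → Exec p s s' C t → Exec (.branch r p q e) s s' C (t + 1)
  | branchFalse {r : ℕ} {p q e : Prog} {s s' : Store} {C : Circuit} {t : ℕ} :
      (s r).head? = some false → Exec q s s' C t → Exec (.branch r p q e) s s' C (t + 1)
  | branchEmpty {r : ℕ} {p q e : Prog} {s s' : Store} {C : Circuit} {t : ℕ} :
      s r = [] → Exec e s s' C t → Exec (.branch r p q e) s s' C (t + 1)
  | loopDone {r : ℕ} {p : Prog} {s : Store} :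
      s r = [] → Exec (.loop r p) s s [] 1
  | loopStep {r : ℕ} {p : Prog} {s s' s'' : Store} {C D : Circuit} {t u : ℕ} :
      s r ≠ [] → Exec p s s' C t → Exec (.loop r p) s' s'' D u →
        Exec (.loop r p) s s'' (C ++ D) (t + u + 1)

/-- The input of an algorithm: stack `0` holds `1^lam`, stack `1` holds `1^n`,
stack `2` holds the bit string `k`, and all other stacks are empty. -/
def initStore (lam n : ℕ) (k : List Bool) : Store := fun r =>
  if r = 0 then List.replicate lam true
  else if r = 1 then List.replicate n true
  else if r = 2 then k
  else []

/-- A quantum polynomial-time algorithm: one program writes out the circuits `C lam`, on input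
`1^lam` (and `1^(n lam)`, the number of qubits), in time polynomial in `lam`. -/
def IsQPT (n : ℕ → ℕ) (C : ℕ → Circuit) : Prop :=
  ∃ (p : Prog) (c : ℕ), ∀ lam : ℕ, ∃ (s : Store) (t : ℕ),
    t ≤ lam ^ c + c ∧ Exec p (initStore lam (n lam) []) s (C lam) t

/-- The same for algorithms with a second, classical input: a key `k ∈ K lam`. -/
def IsKeyedQPT (n : ℕ → ℕ) (K : ℕ → Finset (List Bool)) (C : ℕ → List Bool → Circuit) : Prop :=
  ∃ (p : Prog) (c : ℕ), ∀ lam : ℕ, ∀ k ∈ K lam, ∃ (s : Store) (t : ℕ),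
    t ≤ lam ^ c + c ∧ Exec p (initStore lam (n lam) k) s (C lam k) t

/-! ### Haar measures -/

instance instMeasurableSpaceUGroup (n : ℕ) : MeasurableSpace (UGroup n) := borel _

instance instBorelSpaceUGroup (n : ℕ) : BorelSpace (UGroup n) := ⟨rfl⟩

instance instIsTopologicalGroupUGroup (n : ℕ) : IsTopologicalGroup (UGroup n) :=
  inferInstanceAs (IsTopologicalGroup (unitary (Matrix (Bits n) (Bits n) ℂ)))

instance instCompactSpaceUGroup (n : ℕ) : CompactSpace (UGroup n) := by
  have hK : IsCompact (Set.univ.pi fun _ : Bits n => Set.univ.pi fun _ : Bits n =>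
      Metric.closedBall (0 : ℂ) 1) :=
    isCompact_univ_pi fun _ => isCompact_univ_pi fun _ => isCompact_closedBall _ _
  have hc : IsClosed {A : Matrix (Bits n) (Bits n) ℂ | star A * A = 1 ∧ A * star A = 1} :=
    (isClosed_eq (continuous_star.mul continuous_id) continuous_const).inter
      (isClosed_eq (continuous_id.mul continuous_star) continuous_const)
  refine isCompact_iff_compactSpace.mp (hK.of_isClosed_subset hc ?_)
  intro A hA
  simp only [Set.mem_pi, Set.mem_univ, true_imp_iff, mem_closedBall_zero_iff]
  exact fun i j => entry_norm_bound_of_unitary hA i j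

/-- The Haar probability measure on the unitary group. -/
def haarUnitary (n : ℕ) : Measure (UGroup n) := Measure.haarMeasure ⊤

/-- The Haar (uniform) measure on the pure `n`-qubit states: the law of `V|0…0⟩` for a
Haar-random unitary `V`. -/
def haarState (n : ℕ) : Measure (Bits n → ℂ) :=
  (haarUnitary n).map (fun (V : UGroup n) x => (V : Matrix (Bits n) (Bits n) ℂ) x (fun _ => false))

/-! ### Pseudorandom and unknown unitaries -/

/-- A negligible function of the security parameter. -/
def Negligible (f : ℕ → ℝ) : Prop :=
  Asymptotics.SuperpolynomialDecay atTop (fun lam : ℕ => (lam : ℝ)) f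

/-- A non-negligible threshold: eventually at least an inverse polynomial. -/
def Noticeable (δ : ℕ → ℝ) : Prop :=
  ∃ c : ℕ, ∀ᶠ lam : ℕ in atTop, ((lam : ℝ) ^ c)⁻¹ ≤ δ lam

/-- At most polynomial growth. -/
def PolyBounded (n : ℕ → ℕ) : Prop := ∃ c : ℕ, ∀ lam : ℕ, n lam ≤ lam ^ c + c

/-- The average of a real quantity over a uniformly random key. -/
def keyAverage (K : Finset (List Bool)) (f : List Bool → ℝ) : ℝ := (∑ k ∈ K, f k) / K.card

/-- Efficient computation: the keys are bit strings of polynomial length, and one quantum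
polynomial-time algorithm maps `k` and `|ψ⟩` to `U_k|ψ⟩`, for all keys and all pure states, up to
an error `ε` in the fidelity that is negligible (and zero for exact computation). -/
def EfficientlyComputable (n : ℕ → ℕ) (K : ℕ → Finset (List Bool))
    (U : (lam : ℕ) → List Bool → UGroup (n lam)) : Prop :=
  (∃ c : ℕ, ∀ lam : ℕ, ∀ k ∈ K lam, k.length ≤ lam ^ c + c) ∧
  ∃ (Q : ℕ → List Bool → Circuit) (ε : ℕ → ℝ), IsKeyedQPT n K Q ∧ Negligible ε ∧
    ∀ lam : ℕ, ∀ k ∈ K lam, OracleFree (Q lam k) ∧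
      ∀ ψ : Bits (n lam) → ℂ, ∑ x, ‖ψ x‖ ^ 2 = 1 →
        1 - ε lam ≤ fidelity (outputState (Q lam k) ψ)
          ((U lam k : Matrix (Bits (n lam)) (Bits (n lam)) ℂ) *ᵥ ψ)

/-- Pseudorandomness: no quantum polynomial-time oracle algorithm distinguishes `U_k`, for a
uniformly random key `k`, from a Haar-random unitary. -/
def Pseudorandom (n : ℕ → ℕ) (K : ℕ → Finset (List Bool))
    (U : (lam : ℕ) → List Bool → UGroup (n lam)) : Prop :=
  ∀ A : ℕ → Circuit, IsQPT n A →
    Negligible fun lam =>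
      |keyAverage (K lam) (fun k => acceptProb (U lam k) (A lam)) -
        ∫ V, acceptProb V (A lam) ∂(haarUnitary (n lam))|

/-- A family of pseudorandom unitaries. -/
structure IsPRU (n : ℕ → ℕ) (K : ℕ → Finset (List Bool))
    (U : (lam : ℕ) → List Bool → UGroup (n lam)) : Prop where
  efficientlyComputable : EfficientlyComputable n K U
  pseudorandom : Pseudorandom n K U

/-- The algorithm with circuit `C` estimates `U|ψ⟩`, given `|ψ⟩`, with fidelity at least `δ`. -/
def Estimates {n : ℕ} (C : Circuit) (δ : ℝ) (U : UGroup n) (ψ : Bits n → ℂ) : Prop :=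
  δ ≤ fidelity (outputState C ψ) ((U : Matrix (Bits n) (Bits n) ℂ) *ᵥ ψ)

/-- A family of unknown unitaries: given a single Haar-random state `|ψ⟩` and no access to the
unitary, every quantum polynomial-time algorithm estimates `U_k|ψ⟩`, for a uniformly random key
`k`, with the same probability, up to a negligible difference, as `V|ψ⟩` for a Haar-random `V`. -/
def IsUnknownUnitary (n : ℕ → ℕ) (K : ℕ → Finset (List Bool))
    (U : (lam : ℕ) → List Bool → UGroup (n lam)) : Prop :=
  ∀ A : ℕ → Circuit, IsQPT n A → (∀ lam, OracleFree (A lam)) →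
    ∀ δ : ℕ → ℝ, Noticeable δ →
      Negligible fun lam =>
        |keyAverage (K lam) (fun k =>
            (haarState (n lam)).real {ψ | Estimates (A lam) (δ lam) (U lam k) ψ}) -
          ((haarUnitary (n lam)).prod (haarState (n lam))).real
            {x | Estimates (A lam) (δ lam) x.1 x.2}|

end QPT

end

/-!
Pseudorandom unitaries are unknown: why an estimator for `U_k` yields a distinguisher.

Let `A` be an oracle-free circuit family, `K` its Kraus operators on the output register (`kraus`),
and `d = 2 ^ n`. The squared fidelity of `A|ψ⟩` with `U|ψ⟩` is `∑ₑ |⟨ψ|U†Kₑ|ψ⟩|²` (`overlap`).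

The second moment of a quadratic form `⟨ψ|M|ψ⟩` in a Haar-random unit vector splits into a diagonal
part, bounded by Jensen's inequality in terms of the diagonal entries of `M`, and an off-diagonal
part, whose terms are orthogonal by invariance of the Haar measure under phases and of size
`O(1 / d ^ 2)` by invariance under permutations (`integral_normSq_quadratic_le`). Hence the mean
squared fidelity over Haar-random states is at most `2 b(U) + 4 / d`, where `b(U)` is the mean
squared fidelity over the computational basis states (`basisOverlap`, `integral_overlap_le`). By
Markov's inequality the probability of fidelity at least `δ` is at most `δ⁻² (2 b(U) + 4 / d)`,
for every unitary `U`. For Haar-random `U` the mean of `b(U)` is `1 / d`, so the estimation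
probability is negligible; it remains to see that `b(U_k)` is negligible on average over `k`.

This is where pseudorandomness enters. Random basis states can be prepared with Hadamard and
controlled-not gates, so `b(U)` can be measured with one query: run `A` and the oracle on two copies
of a random basis state, and apply a swap test. The resulting circuit accepts with probability
`1/2 - b(U)/2` (`acceptProb_distinguisher`), and it is uniform: a program that writes it out is
built around the program for `A`, using stacks and arrays that the latter does not name
(`IsQPT.distinguisher`). Therefore the averages of `b` over the keys and over the Haar measure
differ by a negligible amount.
-/

noncomputable section

namespace QPT

/-! ### Linearity and composition of circuits -/

@[simp] theorem applyGate_single {n : ℕ} (U : UGroup n) (g : Gate) (s : Config) (a : ℂ) :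
    applyGate U g (Finsupp.single s a) = a • gateBasis U g s := by
  simp [applyGate]

@[simp] theorem runCircuit_nil {n : ℕ} (U : UGroup n) (χ : State) : runCircuit U [] χ = χ := rfl

theorem runCircuit_cons {n : ℕ} (U : UGroup n) (g : Gate) (C : Circuit) (χ : State) :
    runCircuit U (g :: C) χ = runCircuit U C (applyGate U g χ) := rfl

theorem runCircuit_append {n : ℕ} (U : UGroup n) (C D : Circuit) (χ : State) :
    runCircuit U (C ++ D) χ = runCircuit U D (runCircuit U C χ) := by
  simp [runCircuit, List.foldl_append]

/-- The linear action of a circuit. -/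
def circuitMap {n : ℕ} (U : UGroup n) (C : Circuit) : State →ₗ[ℂ] State where
  toFun := runCircuit U C
  map_add' χ η := by
    induction C generalizing χ η with
    | nil => rfl
    | cons g C ih => simp only [runCircuit_cons, map_add, ih]
  map_smul' a χ := by
    induction C generalizing χ with
    | nil => rfl
    | cons g C ih => simp only [runCircuit_cons, map_smul, ih]

theorem runCircuit_smul {n : ℕ} (U : UGroup n) (C : Circuit) (a : ℂ) (χ : State) :
    runCircuit U C (a • χ) = a • runCircuit U C χ := map_smul (circuitMap U C) a χ

theorem runCircuit_add {n : ℕ} (U : UGroup n) (C : Circuit) (χ η : State) :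
    runCircuit U C (χ + η) = runCircuit U C χ + runCircuit U C η := map_add (circuitMap U C) χ η

theorem runCircuit_sum {n : ℕ} (U : UGroup n) (C : Circuit) {ι : Type*} (I : Finset ι)
    (f : ι → State) : runCircuit U C (∑ i ∈ I, f i) = ∑ i ∈ I, runCircuit U C (f i) :=
  map_sum (circuitMap U C) f I

/-! ### Registers -/

theorem regWire_inj {r r' n m : ℕ} {i : Fin n} {j : Fin m} :
    regWire r i = regWire r' j ↔ r = r' ∧ (i : ℕ) = j := by
  constructor
  · intro h
    have h2 := congrArg (fun w : Wire => w.2.length) h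
    simp only [regWire, List.length_replicate] at h2
    exact ⟨congrArg Prod.fst h, h2⟩
  · rintro ⟨rfl, h⟩
    simp [regWire, h]

theorem regWire_mem_regConfig {n : ℕ} {r r' : ℕ} {x : Bits n} {i : Fin n} :
    regWire r i ∈ regConfig r' x ↔ r = r' ∧ x i = true := by
  simp only [regConfig, Finset.mem_image, Finset.mem_filter, Finset.mem_univ, true_and]
  constructor
  · rintro ⟨j, hj, h⟩
    obtain ⟨hr, h⟩ := regWire_inj.1 h
    rw [← Fin.ext h]
    exact ⟨hr.symm, hj⟩
  · rintro ⟨rfl, h⟩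
    exact ⟨i, h, rfl⟩

theorem fst_of_mem_regConfig {n r : ℕ} {x : Bits n} {w : Wire} (h : w ∈ regConfig r x) :
    w.1 = r := by
  simp only [regConfig, Finset.mem_image] at h
  obtain ⟨i, -, rfl⟩ := h
  rfl

theorem regConfig_subset {n r : ℕ} (x : Bits n) : regConfig r x ⊆ regWires n r :=
  Finset.image_subset_image (Finset.filter_subset _ _)

theorem regWire_mem_regWires {n : ℕ} {r r' : ℕ} {i : Fin n} :
    regWire r i ∈ regWires n r' ↔ r = r' := by
  simp only [regWires, Finset.mem_image, Finset.mem_univ, true_and, regWire_inj]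
  exact ⟨fun ⟨j, h, _⟩ => h.symm, fun h => ⟨i, h.symm, rfl⟩⟩

theorem mem_regWires {n r : ℕ} {w : Wire} : w ∈ regWires n r ↔ ∃ i : Fin n, w = regWire r i := by
  simp only [regWires, Finset.mem_image, Finset.mem_univ, true_and, eq_comm]

theorem mem_writeReg_of_notMem {n r : ℕ} {y : Bits n} {s : Config} {w : Wire}
    (h : w ∉ regWires n r) : w ∈ writeReg r y s ↔ w ∈ s := by
  have h' : w ∉ regConfig r y := fun h' => h (regConfig_subset y h')
  simp [writeReg, h, h']

theorem regWire_mem_writeReg {n r : ℕ} {y : Bits n} {s : Config} {i : Fin n} :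
    regWire r i ∈ writeReg r y s ↔ y i = true := by
  simp [writeReg, regWire_mem_regWires, regWire_mem_regConfig]

@[simp] theorem readReg_writeReg {n r : ℕ} (y : Bits n) (s : Config) :
    readReg n r (writeReg r y s) = y := by
  funext i
  simp [readReg, regWire_mem_writeReg]

@[simp] theorem writeReg_writeReg {n r : ℕ} (y z : Bits n) (s : Config) :
    writeReg r y (writeReg r z s) = writeReg r y s := by
  ext w
  by_cases h : w ∈ regWires n r
  · obtain ⟨i, rfl⟩ := mem_regWires.1 h
    simp [regWire_mem_writeReg]
  · simp [mem_writeReg_of_notMem h]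

@[simp] theorem writeReg_readReg {n r : ℕ} (s : Config) : writeReg r (readReg n r s) s = s := by
  ext w
  by_cases h : w ∈ regWires n r
  · obtain ⟨i, rfl⟩ := mem_regWires.1 h
    simp [regWire_mem_writeReg, readReg]
  · simp [mem_writeReg_of_notMem h]

/-! ### Norm preservation -/

theorem flipWire_flipWire (q : Wire) (s : Config) : flipWire q (flipWire q s) = s := by
  simp [flipWire]

theorem mem_flipWire {q w : Wire} {s : Config} :
    w ∈ flipWire q s ↔ (if w = q then w ∉ s else w ∈ s) := by
  by_cases h : w = q <;> simp [flipWire, Finset.mem_symmDiff, h]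

theorem involutive_controlled_flip (t : Wire) (P : Config → Prop) [DecidablePred P]
    (hP : ∀ s, P (flipWire t s) ↔ P s) :
    Function.Involutive (fun s : Config => if P s then flipWire t s else s) := by
  intro s
  by_cases h : P s <;> simp [h, hP, flipWire_flipWire]

/-- The squared norm of a state. -/
def normSq (χ : State) : ℝ := ∑ s ∈ χ.support, ‖χ s‖ ^ 2

theorem normSq_eq_tsum (χ : State) : normSq χ = ∑' s, ‖χ s‖ ^ 2 := by
  rw [normSq, tsum_eq_sum]
  intro s hs
  simp [Finsupp.notMem_support_iff.1 hs]

theorem applyGate_had_apply {n : ℕ} (U : UGroup n) (q : Wire) (χ : State) (s : Config) :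
    applyGate U (.had q) χ s =
      ((Real.sqrt 2 : ℝ) : ℂ)⁻¹ * (χ (flipWire q s) + (if q ∈ s then -1 else 1) * χ s) := by
  induction χ using Finsupp.induction_linear with
  | zero => simp
  | add χ η h₁ h₂ => rw [map_add, Finsupp.add_apply, h₁, h₂]; simp only [Finsupp.add_apply]; ring
  | single t a =>
    have e1 : (t.erase q = s) ↔ (q ∉ s ∧ (t = s ∨ t = flipWire q s)) := by
      constructor
      · rintro rfl
        refine ⟨by simp, ?_⟩
        by_cases hq : q ∈ t
        · right; ext w; rw [mem_flipWire]; by_cases h : w = q <;> simp [h, hq]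
        · left; simp [hq]
      · rintro ⟨hq, rfl | rfl⟩
        · simp [hq]
        · ext w; rw [Finset.mem_erase, mem_flipWire]; by_cases h : w = q <;> simp [h, hq]
    have e2 : (insert q t = s) ↔ (q ∈ s ∧ (t = s ∨ t = flipWire q s)) := by
      constructor
      · rintro rfl
        refine ⟨by simp, ?_⟩
        by_cases hq : q ∈ t
        · left; simp [hq]
        · right; ext w; rw [mem_flipWire]; by_cases h : w = q <;> simp [h, hq]
      · rintro ⟨hq, rfl | rfl⟩
        · simp [hq]
        · ext w; rw [Finset.mem_insert, mem_flipWire]; by_cases h : w = q <;> simp [h, hq]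
    have hne : flipWire q s ≠ s := by
      intro h
      have := mem_flipWire (q := q) (w := q) (s := s)
      rw [h] at this
      simp at this
    simp only [applyGate_single, gateBasis, Finsupp.smul_apply, Finsupp.add_apply,
      Finsupp.single_apply, e1, e2, smul_eq_mul]
    by_cases hq : q ∈ s <;> by_cases h1 : t = s
    · subst h1
      simp [hq, hne.symm]
      ring
    · by_cases h2 : t = flipWire q s
      · subst h2
        simp [hq, hne, mem_flipWire]
        ring
      · simp [hq, h1, h2]
    · subst h1
      simp [hq, hne.symm]
      ring
    · by_cases h2 : t = flipWire q s
      · subst h2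
        simp [hq, hne, mem_flipWire]
        ring
      · simp [hq, h1, h2]

theorem applyGate_tgate_apply {n : ℕ} (U : UGroup n) (q : Wire) (χ : State) (s : Config) :
    applyGate U (.tgate q) χ s =
      (if q ∈ s then Complex.exp (Complex.I * (Real.pi / 4 : ℝ)) else 1) * χ s := by
  induction χ using Finsupp.induction_linear with
  | zero => simp
  | add χ η h₁ h₂ => rw [map_add, Finsupp.add_apply, h₁, h₂, Finsupp.add_apply, mul_add]
  | single t a =>
    by_cases h : t = s
    · subst h; simp [gateBasis, mul_comm]
    · simp [gateBasis, h]

/-- Amplitudes after a gate that permutes the basis states; as the permutation `f` is an involution,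
no inverse appears. -/
theorem applyGate_apply_of_involutive {n : ℕ} (U : UGroup n) (g : Gate) (f : Config → Config)
    (hf : Function.Involutive f) (hg : ∀ s, gateBasis U g s = Finsupp.single (f s) 1)
    (χ : State) (s : Config) : applyGate U g χ s = χ (f s) := by
  induction χ using Finsupp.induction_linear with
  | zero => simp
  | add χ η h₁ h₂ => rw [map_add, Finsupp.add_apply, h₁, h₂, Finsupp.add_apply]
  | single t a =>
    simp only [applyGate_single, hg, Finsupp.smul_single, smul_eq_mul, mul_one,
      Finsupp.single_apply]
    congr 1
    exact propext (hf.eq_iff)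

theorem normSq_of_apply_perm {χ η : State} (f : Config → Config) (hf : Function.Involutive f)
    (h : ∀ s, η s = χ (f s)) : normSq η = normSq χ := by
  rw [normSq_eq_tsum, normSq_eq_tsum, ← (hf.toPerm f).tsum_eq]
  exact tsum_congr fun s => by rw [h, Function.Involutive.coe_toPerm, hf]

theorem summable_of_finsupp (χ : State) (F : Config → ℝ) (h : ∀ s, χ s = 0 → F s = 0) :
    Summable F :=
  summable_of_ne_finset_zero (s := χ.support) fun s hs => h s (Finsupp.notMem_support_iff.1 hs)

theorem normSq_had {n : ℕ} (U : UGroup n) (q : Wire) (χ : State) :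
    normSq (applyGate U (.had q) χ) = normSq χ := by
  have hinv : Function.Involutive (flipWire q) := flipWire_flipWire q
  -- the cross term changes sign when the wire is negated
  let X : Config → ℝ := fun s => (if q ∈ s then -1 else 1) * (χ (flipWire q s) * star (χ s)).re
  have hX : ∀ s, X (flipWire q s) = - X s := by
    intro s
    have : (χ s * star (χ (flipWire q s))).re = (χ (flipWire q s) * star (χ s)).re := by
      simp [Complex.mul_re]; ring
    simp only [X, flipWire_flipWire, this, mem_flipWire]
    by_cases h : q ∈ s <;> simp [h]
  have hX0 : ∑' s, X s = 0 := by
    have h := (hinv.toPerm (flipWire q)).tsum_eq X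
    simp only [Function.Involutive.coe_toPerm, hX, tsum_neg] at h
    linarith
  have key : ∀ s, ‖applyGate U (.had q) χ s‖ ^ 2 =
      2⁻¹ * ‖χ (flipWire q s)‖ ^ 2 + 2⁻¹ * ‖χ s‖ ^ 2 + X s := by
    intro s
    rw [applyGate_had_apply, norm_mul, mul_pow]
    have h2 : ‖((Real.sqrt 2 : ℝ) : ℂ)⁻¹‖ ^ 2 = 2⁻¹ := by
      rw [norm_inv, Complex.norm_real, inv_pow, Real.norm_eq_abs, sq_abs]
      norm_num
    rw [h2]
    simp only [X, ← Complex.normSq_eq_norm_sq, Complex.normSq_apply]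
    by_cases h : q ∈ s <;> simp [h] <;> ring
  have hsum : Summable fun s => ‖χ s‖ ^ 2 := summable_of_finsupp χ _ fun s h => by simp [h]
  have hsum' : Summable fun s => ‖χ (flipWire q s)‖ ^ 2 :=
    (hinv.toPerm (flipWire q)).summable_iff.2 hsum
  have hsumX : Summable X := summable_of_finsupp χ _ fun s h => by simp [X, h]
  have hflip : ∑' s, ‖χ (flipWire q s)‖ ^ 2 = ∑' s, ‖χ s‖ ^ 2 :=
    (hinv.toPerm (flipWire q)).tsum_eq (fun s => ‖χ s‖ ^ 2)
  rw [normSq_eq_tsum, normSq_eq_tsum, tsum_congr key,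
    ((hsum'.mul_left _).add (hsum.mul_left _)).tsum_add hsumX,
    (hsum'.mul_left _).tsum_add (hsum.mul_left _), tsum_mul_left, tsum_mul_left, hX0, hflip]
  ring

theorem involutive_cnot (c t : Wire) :
    Function.Involutive (fun s : Config => if c ∈ s ∧ c ≠ t then flipWire t s else s) := by
  refine involutive_controlled_flip t (fun s => c ∈ s ∧ c ≠ t) fun s => ?_
  rw [mem_flipWire]
  by_cases h : c = t <;> simp [h]

theorem involutive_ccnot (c₁ c₂ t : Wire) :
    Function.Involutive (fun s : Config =>
      if c₁ ∈ s ∧ c₂ ∈ s ∧ c₁ ≠ t ∧ c₂ ≠ t then flipWire t s else s) := by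
  refine involutive_controlled_flip t (fun s => c₁ ∈ s ∧ c₂ ∈ s ∧ c₁ ≠ t ∧ c₂ ≠ t) fun s => ?_
  rw [mem_flipWire, mem_flipWire]
  by_cases h : c₁ = t <;> by_cases h' : c₂ = t <;> simp [h, h']

theorem normSq_runCircuit {n : ℕ} (U : UGroup n) (C : Circuit) (hC : OracleFree C) (χ : State) :
    normSq (runCircuit U C χ) = normSq χ := by
  induction C generalizing χ with
  | nil => rfl
  | cons g C ih =>
    rw [runCircuit_cons, ih fun r h => hC r (List.mem_cons_of_mem _ h)]
    cases g with
    | had q => exact normSq_had U q χ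
    | tgate q =>
      rw [normSq_eq_tsum, normSq_eq_tsum]
      refine tsum_congr fun s => ?_
      rw [applyGate_tgate_apply, norm_mul]
      by_cases h : q ∈ s
      · rw [if_pos h, mul_comm Complex.I, Complex.norm_exp_ofReal_mul_I, one_mul]
      · simp [h]
    | cnot c t =>
      exact normSq_of_apply_perm _ (involutive_cnot c t)
        (applyGate_apply_of_involutive U _ _ (involutive_cnot c t) (fun s => rfl) χ)
    | ccnot c₁ c₂ t =>
      exact normSq_of_apply_perm _ (involutive_ccnot c₁ c₂ t)
        (applyGate_apply_of_involutive U _ _ (involutive_ccnot c₁ c₂ t) (fun s => rfl) χ)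
    | oracle r => exact absurd List.mem_cons_self (hC r)

/-! ### Locality of circuits -/

/-- All wires that the gate acts on (oracle registers excepted) lie in arrays with names
below `N`. -/
def ArraysBelow (N : ℕ) : Gate → Prop
  | .had q => q.1 < N
  | .tgate q => q.1 < N
  | .cnot c t => c.1 < N ∧ t.1 < N
  | .ccnot c₁ c₂ t => c₁.1 < N ∧ c₂.1 < N ∧ t.1 < N
  | .oracle _ => True

theorem flipWire_union {q : Wire} {T : Config} (h : q ∉ T) (s : Config) :
    flipWire q (s ∪ T) = flipWire q s ∪ T := by
  ext w
  simp only [mem_flipWire, Finset.mem_union]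
  by_cases hw : w = q
  · subst hw; simp [h]
  · simp [hw]

/-- A circuit without oracle queries does not notice values on wires that it does not touch. -/
theorem runCircuit_mapDomain_union {n m : ℕ} (U : UGroup n) (V : UGroup m) {N : ℕ} {T : Config}
    (hT : ∀ w ∈ T, N ≤ w.1) (C : Circuit) (hC : OracleFree C) (hN : ∀ g ∈ C, ArraysBelow N g)
    (χ : State) :
    runCircuit U C (χ.mapDomain (· ∪ T)) = (runCircuit V C χ).mapDomain (· ∪ T) := by
  have hnot : ∀ {q : Wire}, q.1 < N → q ∉ T := fun hq h => absurd (hT _ h) (not_le.2 hq)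
  induction C generalizing χ with
  | nil => rfl
  | cons g C ih =>
    rw [runCircuit_cons, runCircuit_cons,
      ← ih (fun r h => hC r (List.mem_cons_of_mem _ h)) fun g h => hN g (List.mem_cons_of_mem _ h)]
    congr 1
    have hg := hN g List.mem_cons_self
    induction χ using Finsupp.induction_linear with
    | zero => simp
    | add χ η h₁ h₂ => simp only [Finsupp.mapDomain_add, map_add, h₁, h₂]
    | single s a =>
      rw [Finsupp.mapDomain_single, applyGate_single, applyGate_single, Finsupp.mapDomain_smul]
      congr 1
      cases g with
      | had q =>
        have hq := hnot hg
        simp only [gateBasis, Finsupp.mapDomain_smul, Finsupp.mapDomain_add,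
          Finsupp.mapDomain_single, Finset.mem_union, hq, or_false, Finset.insert_union]
        rw [Finset.erase_union_distrib, Finset.erase_eq_of_notMem hq]
      | tgate q =>
        simp [gateBasis, Finsupp.mapDomain_single, hnot hg]
      | cnot c t =>
        simp only [gateBasis, Finsupp.mapDomain_single, Finset.mem_union, hnot hg.1, or_false,
          flipWire_union (hnot hg.2)]
        split_ifs <;> rfl
      | ccnot c₁ c₂ t =>
        simp only [gateBasis, Finsupp.mapDomain_single, Finset.mem_union, hnot hg.1, hnot hg.2.1,
          or_false, flipWire_union (hnot hg.2.2)]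
        split_ifs <;> rfl
      | oracle r => exact absurd List.mem_cons_self (hC r)

/-- All wires with value `1` lie in arrays with names below `N`. -/
def ConfigBelow (N : ℕ) (s : Config) : Prop := ∀ w ∈ s, w.1 < N

theorem ConfigBelow.flipWire {N : ℕ} {s : Config} (hs : ConfigBelow N s) {q : Wire}
    (hq : q.1 < N) : ConfigBelow N (flipWire q s) := by
  intro w hw
  rw [mem_flipWire] at hw
  split_ifs at hw with h
  · rwa [h]
  · exact hs w hw

/-- The wires of arrays that a circuit does not touch keep the value `0`. -/
theorem runCircuit_mem_supported {n : ℕ} (U : UGroup n) {N : ℕ} (C : Circuit) (hC : OracleFree C)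
    (hN : ∀ g ∈ C, ArraysBelow N g) {χ : State}
    (hχ : χ ∈ Finsupp.supported ℂ ℂ {s | ConfigBelow N s}) :
    runCircuit U C χ ∈ Finsupp.supported ℂ ℂ {s | ConfigBelow N s} := by
  induction C generalizing χ with
  | nil => exact hχ
  | cons g C ih =>
    refine ih (fun r h => hC r (List.mem_cons_of_mem _ h))
      (fun g h => hN g (List.mem_cons_of_mem _ h)) ?_
    have hg := hN g List.mem_cons_self
    change Finsupp.linearCombination ℂ (gateBasis U g) χ ∈ _
    rw [Finsupp.linearCombination_apply]
    refine Submodule.sum_mem _ fun s hs => Submodule.smul_mem _ _ ?_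
    have hs : ConfigBelow N s := (Finsupp.mem_supported ℂ χ).1 hχ hs
    cases g with
    | had q =>
      refine Submodule.smul_mem _ _ (Submodule.add_mem _ ?_ (Submodule.smul_mem _ _ ?_))
      · exact Finsupp.single_mem_supported ℂ _ fun w hw => hs w (Finset.mem_of_mem_erase hw)
      · refine Finsupp.single_mem_supported ℂ _ fun w hw => ?_
        rcases Finset.mem_insert.1 hw with rfl | hw
        · exact hg
        · exact hs w hw
    | tgate q => exact Finsupp.single_mem_supported ℂ _ hs
    | cnot c t =>
      refine Finsupp.single_mem_supported ℂ _ ?_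
      split_ifs
      · exact hs.flipWire hg.2
      · exact hs
    | ccnot c₁ c₂ t =>
      refine Finsupp.single_mem_supported ℂ _ ?_
      split_ifs
      · exact hs.flipWire hg.2.2
      · exact hs
    | oracle r => exact absurd List.mem_cons_self (hC r)

/-! ### Programs: names, locality, loops -/

/-- A strict upper bound for the names of the arrays and of the stacks in a gate template. -/
def GateOn.nameBound : GateOn (ℕ × ℕ) → ℕ
  | .had q => max q.1 q.2 + 1
  | .tgate q => max q.1 q.2 + 1
  | .cnot c t => max (max c.1 c.2) (max t.1 t.2) + 1
  | .ccnot c₁ c₂ t => max (max c₁.1 c₁.2) (max (max c₂.1 c₂.2) (max t.1 t.2)) + 1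
  | .oracle _ => 0

/-- A strict upper bound for the names of the arrays and of the stacks that occur in a program;
names of oracle registers do not count. -/
def Prog.nameBound : Prog → ℕ
  | .skip => 0
  | .push r _ => r + 1
  | .pop r => r + 1
  | .emit g => g.nameBound
  | .seq p q => max p.nameBound q.nameBound
  | .branch r p q e => max (r + 1) (max p.nameBound (max q.nameBound e.nameBound))
  | .loop r p => max (r + 1) p.nameBound

theorem arraysBelow_map {N : ℕ} {g : GateOn (ℕ × ℕ)} (h : g.nameBound ≤ N) (s : Store) :
    ArraysBelow N (g.map fun w => (w.1, s w.2)) := by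
  cases g <;> simp only [GateOn.nameBound, GateOn.map, ArraysBelow] at * <;> omega

theorem Exec.arraysBelow {N : ℕ} {p : Prog} {s s' : Store} {C : Circuit} {t : ℕ}
    (h : Exec p s s' C t) (hp : p.nameBound ≤ N) : ∀ g ∈ C, ArraysBelow N g := by
  induction h <;>
    simp_all [Prog.nameBound, or_imp, arraysBelow_map]

theorem map_congr_store {N : ℕ} {g : GateOn (ℕ × ℕ)} (h : g.nameBound ≤ N) {s v : Store}
    (hv : ∀ r < N, v r = s r) :
    (g.map fun w => (w.1, v w.2)) = g.map fun w => (w.1, s w.2) := by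
  cases g <;> simp only [GateOn.nameBound, GateOn.map] at * <;>
    (repeat rw [hv _ (by omega)])

/-- An execution depends only on the stacks that the program names, and leaves all others
unchanged. -/
theorem Exec.frame {N : ℕ} {p : Prog} {s s' : Store} {C : Circuit} {t : ℕ}
    (h : Exec p s s' C t) (hp : p.nameBound ≤ N) (v : Store) (hv : ∀ r < N, v r = s r) :
    ∃ v' : Store, Exec p v v' C t ∧ (∀ r < N, v' r = s' r) ∧ ∀ r, N ≤ r → v' r = v r := by
  have hupd : ∀ (s v : Store) (r : ℕ) (l : List Bool), r < N → (∀ i < N, v i = s i) →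
      (∀ i < N, Function.update v r l i = Function.update s r l i) ∧
      ∀ i, N ≤ i → Function.update v r l i = v i := by
    intro s v r l hr hv
    refine ⟨fun i hi => ?_, fun i hi => Function.update_of_ne (by omega) _ _⟩
    by_cases h : i = r
    · subst h; simp
    · simp [h, hv i hi]
  induction h generalizing v with
  | skip s => exact ⟨v, .skip v, hv, fun _ _ => rfl⟩
  | push r b s =>
    have hr : r < N := hp
    have := hupd s v r (b :: s r) hr hv
    exact ⟨_, .push r b v, by rwa [hv r hr]⟩
  | pop r s =>
    have hr : r < N := hp
    have := hupd s v r (s r).tail hr hv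
    exact ⟨_, .pop r v, by rwa [hv r hr]⟩
  | emit g s =>
    refine ⟨v, ?_, hv, fun _ _ => rfl⟩
    rw [← map_congr_store hp hv]
    exact .emit g v
  | seq _ _ ih₁ ih₂ =>
    simp only [Prog.nameBound, max_le_iff] at hp
    obtain ⟨v₁, e₁, h₁, k₁⟩ := ih₁ hp.1 v hv
    obtain ⟨v₂, e₂, h₂, k₂⟩ := ih₂ hp.2 v₁ h₁
    exact ⟨v₂, .seq e₁ e₂, h₂, fun r hr => (k₂ r hr).trans (k₁ r hr)⟩
  | branchTrue hb _ ih =>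
    simp only [Prog.nameBound, max_le_iff] at hp
    obtain ⟨v₁, e₁, h₁, k₁⟩ := ih hp.2.1 v hv
    exact ⟨v₁, .branchTrue (by rw [hv _ hp.1]; exact hb) e₁, h₁, k₁⟩
  | branchFalse hb _ ih =>
    simp only [Prog.nameBound, max_le_iff] at hp
    obtain ⟨v₁, e₁, h₁, k₁⟩ := ih hp.2.2.1 v hv
    exact ⟨v₁, .branchFalse (by rw [hv _ hp.1]; exact hb) e₁, h₁, k₁⟩
  | branchEmpty hb _ ih =>
    simp only [Prog.nameBound, max_le_iff] at hp
    obtain ⟨v₁, e₁, h₁, k₁⟩ := ih hp.2.2.2 v hv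
    exact ⟨v₁, .branchEmpty (by rw [hv _ hp.1]; exact hb) e₁, h₁, k₁⟩
  | loopDone hb =>
    simp only [Prog.nameBound, max_le_iff] at hp
    exact ⟨v, .loopDone (by rw [hv _ hp.1]; exact hb), hv, fun _ _ => rfl⟩
  | loopStep hb _ _ ih₁ ih₂ =>
    have hp' := hp
    simp only [Prog.nameBound, max_le_iff] at hp'
    obtain ⟨v₁, e₁, h₁, k₁⟩ := ih₁ hp'.2 v hv
    obtain ⟨v₂, e₂, h₂, k₂⟩ := ih₂ hp v₁ h₁
    exact ⟨v₂, .loopStep (by rw [hv _ hp'.1]; exact hb) e₁ e₂, h₂,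
      fun r hr => (k₂ r hr).trans (k₁ r hr)⟩

/-- A loop whose body maps the store `S i` to `S (i + 1)`, as long as the stack `r` of the
store is not empty, writing out `D i`. -/
theorem Exec.loop_range {r : ℕ} {p : Prog} {S : ℕ → Store} {D : ℕ → Circuit} {t m : ℕ}
    (hne : ∀ i < m, S i r ≠ []) (hend : S m r = [])
    (hbody : ∀ i < m, Exec p (S i) (S (i + 1)) (D i) t) :
    Exec (.loop r p) (S 0) (S m) ((List.range m).flatMap D) (m * (t + 1) + 1) := by
  induction m generalizing S D with
  | zero => simpa using Exec.loopDone hend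
  | succ m ih =>
    have h := ih (S := fun i => S (i + 1)) (D := fun i => D (i + 1))
      (fun i hi => hne (i + 1) (by omega)) hend (fun i hi => hbody (i + 1) (by omega))
    have h' := Exec.loopStep (hne 0 (by omega)) (hbody 0 (by omega)) h
    rw [List.range_succ_eq_map, List.flatMap_cons, List.flatMap_map]
    convert h' using 1
    ring

/-- Execute a list of instructions in order. -/
def Prog.ofList : List Prog → Prog
  | [] => .skip
  | p :: l => .seq p (Prog.ofList l)

/-! ### The distinguisher and the program that writes it out -/

/-- The `i`-th wire of the registers in array `r`. For `i : Fin n` it is definitionally equal to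
`regWire r i`; here the index is a natural number, as it is in loops. -/
def wire (r i : ℕ) : Wire := (r, List.replicate i true)

/-- Make the `i`-th wire of array `N` uniformly random and copy it to the arrays `0` and `N + 1`. -/
def prepGates (N i : ℕ) : Circuit :=
  [.had (wire N i), .cnot (wire N i) (wire 0 i), .cnot (wire N i) (wire (N + 1) i)]

/-- Exchange the `i`-th wires of the arrays `0` and `N + 1`, controlled by the first wire of
array `N + 2`. -/
def swapGates (N i : ℕ) : Circuit :=
  [.cnot (wire (N + 1) i) (wire 0 i), .ccnot (wire (N + 2) 0) (wire 0 i) (wire (N + 1) i),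
    .cnot (wire (N + 1) i) (wire 0 i)]

/-- The swap test of the registers in the arrays `0` and `N + 1`; its result is finally exchanged
with the output wire. -/
def swapTest (N n : ℕ) : Circuit :=
  .had (wire (N + 2) 0) :: ((List.range n).flatMap (swapGates N) ++
    [.had (wire (N + 2) 0), .cnot (wire (N + 2) 0) (wire 0 0), .cnot (wire 0 0) (wire (N + 2) 0),
      .cnot (wire (N + 2) 0) (wire 0 0)])

/-- The distinguisher: prepare a random basis state twice, apply the oracle to one copy and the
circuit `A` to the other, and compare the results by a swap test. -/
def distinguisher (N n : ℕ) (A : Circuit) : Circuit :=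
  (List.range n).flatMap (prepGates N) ++ (.oracle (N + 1) :: (A ++ swapTest N n))

/-- The program that writes out the preparation.  The address is in stack `M + 1`. -/
def prepProg (N M : ℕ) : Prog :=
  .loop 1 (.ofList [.emit (.had (N, M + 1)), .emit (.cnot (N, M + 1) (0, M + 1)),
    .emit (.cnot (N, M + 1) (N + 1, M + 1)), .push (M + 1) true, .pop 1])

/-- Move the contents of stack `M + 1` to stack `1`, and copy them to stack `M + 2`. -/
def restoreProg (M : ℕ) : Prog :=
  .loop (M + 1) (.ofList [.push 1 true, .push (M + 2) true, .pop (M + 1)])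

/-- The program that writes out the swap test.  Stack `M` is empty. -/
def swapTestProg (N M : ℕ) : Prog :=
  .ofList [.emit (.had (N + 2, M)),
    .loop (M + 2) (.ofList [.emit (.cnot (N + 1, M + 1) (0, M + 1)),
      .emit (.ccnot (N + 2, M) (0, M + 1) (N + 1, M + 1)),
      .emit (.cnot (N + 1, M + 1) (0, M + 1)), .push (M + 1) true, .pop (M + 2)]),
    .emit (.had (N + 2, M)), .emit (.cnot (N + 2, M) (0, M)), .emit (.cnot (0, M) (N + 2, M)),
    .emit (.cnot (N + 2, M) (0, M))]

/-- The program that writes out the distinguisher, from one that writes out the circuit under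
test; `N` is larger than all names in that program. -/
def distinguisherProg (N : ℕ) (p : Prog) : Prog :=
  .ofList [prepProg N N, restoreProg N, .emit (.oracle (N + 1)), p, swapTestProg N N]

theorem Exec.cast {p q : Prog} {s v s' v' : Store} {C D : Circuit} {t u : ℕ}
    (h : Exec p s s' C t) (hp : p = q) (hs : s = v) (hs' : s' = v') (hC : C = D) (ht : t = u) :
    Exec q v v' D u := by
  subst hp hs hs' hC ht; exact h

theorem replicate_cons (i : ℕ) : true :: List.replicate i true = List.replicate (i + 1) true := rfl

theorem exec_prepProg {N M n : ℕ} (hM : 1 < M) {s : Store} (h1 : s 1 = List.replicate n true)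
    (hL : s (M + 1) = []) :
    Exec (prepProg N M) s
      (Function.update (Function.update s (M + 1) (List.replicate n true)) 1 [])
      ((List.range n).flatMap (prepGates N)) (n * 7 + 1) := by
  have h := Exec.loop_range (r := 1) (m := n) (t := 6) (D := prepGates N)
    (p := .ofList [.emit (.had (N, M + 1)), .emit (.cnot (N, M + 1) (0, M + 1)),
      .emit (.cnot (N, M + 1) (N + 1, M + 1)), .push (M + 1) true, .pop 1])
    (S := fun i => Function.update (Function.update s (M + 1) (List.replicate i true)) 1
      (List.replicate (n - i) true)) ?_ ?_ ?_
  · refine h.cast rfl ?_ (by simp) rfl rfl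
    funext r
    by_cases hr : r = 1
    · subst hr; simp [h1]
    · by_cases hr' : r = M + 1
      · subst hr'; simp [hL, Nat.ne_of_gt (Nat.zero_lt_of_lt hM)]
      · simp [hr, hr']
  · intro i hi
    simp only [Function.update_self, ne_eq, List.replicate_eq_nil_iff]
    omega
  · simp
  · intro i hi
    have hne : M ≠ 0 := by omega
    set S := Function.update (Function.update s (M + 1) (List.replicate i true)) 1
      (List.replicate (n - i) true) with hS
    have hSL : S (M + 1) = List.replicate i true := by simp [hS, hne]
    have e := Exec.seq (.emit (.had (N, M + 1)) S) <|
      .seq (.emit (.cnot (N, M + 1) (0, M + 1)) S) <|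
      .seq (.emit (.cnot (N, M + 1) (N + 1, M + 1)) S) <|
      .seq (.push (M + 1) true S) <| .seq (.pop 1 _) (.skip _)
    have hend : Function.update (Function.update S (M + 1) (true :: S (M + 1))) 1
        ((Function.update S (M + 1) (true :: S (M + 1))) 1).tail =
        Function.update (Function.update s (M + 1) (List.replicate (i + 1) true)) 1
          (List.replicate (n - (i + 1)) true) := by
      funext r
      by_cases hr : r = 1
      · subst hr
        simp [hne, hS, Nat.sub_add_eq]
      · by_cases hr' : r = M + 1
        · subst hr'; simp [hSL, hne, replicate_cons]
        · simp [hr, hr', hS]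
    refine e.cast rfl rfl hend ?_ rfl
    simp [GateOn.map, hSL, prepGates, wire]

theorem exec_restoreProg {M n : ℕ} (hM : 1 < M) {s : Store} (h1 : s 1 = []) (h2 : s (M + 2) = [])
    (hL : s (M + 1) = List.replicate n true) :
    Exec (restoreProg M) s
      (Function.update (Function.update (Function.update s (M + 1) []) 1 (List.replicate n true))
        (M + 2) (List.replicate n true)) [] (n * 5 + 1) := by
  have h := Exec.loop_range (r := M + 1) (m := n) (t := 4) (D := fun _ => [])
    (p := .ofList [.push 1 true, .push (M + 2) true, .pop (M + 1)])
    (S := fun i => Function.update (Function.update (Function.update s (M + 1)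
      (List.replicate (n - i) true)) 1 (List.replicate i true)) (M + 2) (List.replicate i true))
      ?_ ?_ ?_
  · refine h.cast rfl ?_ (by simp) (by simp) rfl
    funext r
    by_cases hr : r = 1
    · subst hr; simp [h1]
    · by_cases hr' : r = M + 1
      · subst hr'; simp [hL, Nat.ne_of_gt (Nat.zero_lt_of_lt hM)]
      · by_cases hr'' : r = M + 2
        · subst hr''; simp [h2]
        · simp [hr, hr', hr'']
  · intro i hi
    have hne : M ≠ 0 := by omega
    simp [hne]
    omega
  · have hne : M ≠ 0 := by omega
    simp [hne]
  · intro i hi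
    have hne : M ≠ 0 := by omega
    set S := Function.update (Function.update (Function.update s (M + 1)
      (List.replicate (n - i) true)) 1 (List.replicate i true)) (M + 2)
      (List.replicate i true) with hS
    have e := Exec.seq (.push 1 true S) <| .seq (.push (M + 2) true _) <|
      .seq (.pop (M + 1) _) (.skip _)
    refine e.cast rfl rfl ?_ rfl rfl
    funext r
    by_cases hr : r = 1
    · subst hr; simp [hS, hne, replicate_cons]
    · by_cases hr' : r = M + 1
      · subst hr'; simp [hne, hS, Nat.sub_add_eq]
      · by_cases hr'' : r = M + 2
        · subst hr''; simp [hr, hS, replicate_cons]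
        · simp [hr, hr', hr'', hS]

theorem exec_swapTestProg {N M n : ℕ} {s : Store} (h0 : s M = []) (hL : s (M + 1) = [])
    (h2 : s (M + 2) = List.replicate n true) :
    ∃ s', Exec (swapTestProg N M) s s' (swapTest N n) (n * 7 + 7) := by
  have h := Exec.loop_range (r := M + 2) (m := n) (t := 6) (D := swapGates N)
    (p := .ofList [.emit (.cnot (N + 1, M + 1) (0, M + 1)),
      .emit (.ccnot (N + 2, M) (0, M + 1) (N + 1, M + 1)),
      .emit (.cnot (N + 1, M + 1) (0, M + 1)), .push (M + 1) true, .pop (M + 2)])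
    (S := fun i => Function.update (Function.update s (M + 1) (List.replicate i true)) (M + 2)
      (List.replicate (n - i) true)) ?_ ?_ ?_
  · set S' := Function.update (Function.update s (M + 1) (List.replicate n true)) (M + 2)
      (List.replicate (n - n) true) with hS'
    have hS0 : Function.update (Function.update s (M + 1) (List.replicate 0 true)) (M + 2)
      (List.replicate (n - 0) true) = s := by
      funext r
      by_cases hr : r = M + 2
      · subst hr; simp [h2]
      · by_cases hr' : r = M + 1
        · subst hr'; simp [hL]
        · simp [hr, hr']
    rw [hS0] at h
    have hM : S' M = [] := by simp [hS', h0]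
    have e := Exec.seq (.emit (.had (N + 2, M)) s) <| .seq h <|
      .seq (.emit (.had (N + 2, M)) S') <| .seq (.emit (.cnot (N + 2, M) (0, M)) S') <|
      .seq (.emit (.cnot (0, M) (N + 2, M)) S') <|
      .seq (.emit (.cnot (N + 2, M) (0, M)) S') (.skip _)
    refine ⟨S', ?_⟩
    refine e.cast rfl rfl rfl ?_ (by ring)
    simp [swapTest, GateOn.map, wire, hM, h0]
  · intro i hi
    simp only [Function.update_self, ne_eq, List.replicate_eq_nil_iff]
    omega
  · simp
  · intro i hi
    set S := Function.update (Function.update s (M + 1) (List.replicate i true)) (M + 2)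
      (List.replicate (n - i) true) with hS
    have hSL : S (M + 1) = List.replicate i true := by simp [hS]
    have hSM : S M = [] := by simp [hS, h0]
    have e := Exec.seq (.emit (.cnot (N + 1, M + 1) (0, M + 1)) S) <|
      .seq (.emit (.ccnot (N + 2, M) (0, M + 1) (N + 1, M + 1)) S) <|
      .seq (.emit (.cnot (N + 1, M + 1) (0, M + 1)) S) <|
      .seq (.push (M + 1) true S) <| .seq (.pop (M + 2) _) (.skip _)
    have hend : Function.update (Function.update S (M + 1) (true :: S (M + 1))) (M + 2)
        ((Function.update S (M + 1) (true :: S (M + 1))) (M + 2)).tail =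
        Function.update (Function.update s (M + 1) (List.replicate (i + 1) true)) (M + 2)
          (List.replicate (n - (i + 1)) true) := by
      funext r
      by_cases hr : r = M + 2
      · subst hr
        simp [hS, Nat.sub_add_eq]
      · by_cases hr' : r = M + 1
        · subst hr'; simp [hSL, replicate_cons]
        · simp [hr, hr', hS]
    refine e.cast rfl rfl hend ?_ rfl
    simp [GateOn.map, hSL, hSM, swapGates, wire]

/-- The program under test runs on a memory that agrees with its own initial memory on all stacks it
names; the frame property does the rest. -/
theorem exec_distinguisherProg {N lam n t : ℕ} {p : Prog} {s : Store} {A : Circuit} (hN : 1 < N)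
    (hp : p.nameBound ≤ N) (h : Exec p (initStore lam n []) s A t) :
    ∃ s', Exec (distinguisherProg N p) (initStore lam n []) s' (distinguisher N n A)
      (n * 19 + 11 + t) := by
  have e₁ := exec_prepProg (N := N) (n := n) hN (s := initStore lam n []) (by simp [initStore])
    (by simp [initStore]; omega)
  have hN0 : N ≠ 0 := by omega
  have hN1 : N ≠ 1 := by omega
  have e₂ := exec_restoreProg (n := n) hN
    (s := Function.update (Function.update (initStore lam n []) (N + 1) (List.replicate n true))
      1 []) (by simp) (by simp [initStore]) (by simp [hN0])
  set v := Function.update (Function.update (Function.update (Function.update (Function.update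
    (initStore lam n []) (N + 1) (List.replicate n true)) 1 []) (N + 1) []) 1
    (List.replicate n true)) (N + 2) (List.replicate n true) with hv
  obtain ⟨v', e₃, -, hv'⟩ := h.frame hp v fun r hr => by
    have h1 : r ≠ N + 1 := by omega
    have h2 : r ≠ N + 2 := by omega
    by_cases hr1 : r = 1
    · subst hr1; simp [hv, initStore]
    · simp [hv, h1, h2, hr1]
  obtain ⟨s', e₄⟩ := exec_swapTestProg (N := N) (M := N) (n := n) (s := v')
    (by rw [hv' N le_rfl]; simp [hv, initStore, hN0, hN1])
    (by rw [hv' (N + 1) (by omega)]; simp [hv, hN0])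
    (by rw [hv' (N + 2) (by omega)]; simp [hv])
  refine ⟨s', ?_⟩
  have e := Exec.seq e₁ <| .seq e₂ <| .seq (.emit (.oracle (N + 1)) v) <| .seq e₃ <|
    .seq e₄ (.skip _)
  refine e.cast rfl rfl rfl ?_ (by ring)
  simp [distinguisher, GateOn.map]

theorem PolyBounded.add {f g : ℕ → ℕ} (hf : PolyBounded f) (hg : PolyBounded g) :
    PolyBounded fun lam => f lam + g lam := by
  obtain ⟨a, ha⟩ := hf
  obtain ⟨b, hb⟩ := hg
  refine ⟨a + b + 2, fun lam => (add_le_add (ha lam) (hb lam)).trans ?_⟩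
  rcases lam.eq_zero_or_pos with rfl | h
  · have h1 : ∀ c : ℕ, (0 : ℕ) ^ c ≤ 1 := fun c => by rcases c with _ | c <;> simp
    linarith [h1 a, h1 b, Nat.zero_le (0 ^ (a + b + 2))]
  · have h1 : lam ^ a ≤ lam ^ (a + b) := Nat.pow_le_pow_right h (by omega)
    have h2 : lam ^ b ≤ lam ^ (a + b) := Nat.pow_le_pow_right h (by omega)
    rcases Nat.lt_or_eq_of_le h with h | rfl
    · have h3 : lam ^ (a + b) * 2 ≤ lam ^ (a + b) * lam ^ 2 :=
        Nat.mul_le_mul_left _ (by nlinarith)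
      rw [← pow_add] at h3
      omega
    · simp
      omega

theorem PolyBounded.const (k : ℕ) : PolyBounded fun _ => k := ⟨k, fun _ => Nat.le_add_left _ _⟩

theorem PolyBounded.mul_const {f : ℕ → ℕ} (hf : PolyBounded f) (k : ℕ) :
    PolyBounded fun lam => f lam * k := by
  induction k with
  | zero => simpa using PolyBounded.const 0
  | succ k ih => simpa only [mul_add_one] using ih.add hf

/-- A uniform family of circuits has bounded array names, and the distinguishers built from it
are again uniform. -/
theorem IsQPT.distinguisher {n : ℕ → ℕ} (hn : PolyBounded n) {A : ℕ → Circuit} (hA : IsQPT n A) :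
    ∃ N : ℕ, 1 < N ∧ (∀ lam, ∀ g ∈ A lam, ArraysBelow N g) ∧
      IsQPT n fun lam => distinguisher N (n lam) (A lam) := by
  obtain ⟨p, c, h⟩ := hA
  refine ⟨max p.nameBound 2, by omega, fun lam => ?_, ?_⟩
  · obtain ⟨s, t, -, e⟩ := h lam
    exact e.arraysBelow (le_max_left _ _)
  · obtain ⟨c', hc'⟩ := ((hn.mul_const 19).add (PolyBounded.const 11)).add ⟨c, fun _ => le_rfl⟩
    refine ⟨distinguisherProg (max p.nameBound 2) p, c', fun lam => ?_⟩
    obtain ⟨s, t, ht, e⟩ := h lam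
    obtain ⟨s', e'⟩ := exec_distinguisherProg (N := max p.nameBound 2) (by omega)
      (le_max_left _ _) e
    exact ⟨s', _, (add_le_add_right ht _).trans (hc' lam), e'⟩

/-! ### Haar moments -/

instance isProbabilityMeasure_haarUnitary (n : ℕ) : IsProbabilityMeasure (haarUnitary n) :=
  ⟨Measure.haarMeasure_self (K₀ := ⊤)⟩

instance isMulLeftInvariant_haarUnitary (n : ℕ) : (haarUnitary n).IsMulLeftInvariant :=
  inferInstanceAs (Measure.haarMeasure _).IsMulLeftInvariant

theorem continuous_entry {n : ℕ} (a b : Bits n) :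
    Continuous fun V : UGroup n => (V : Matrix (Bits n) (Bits n) ℂ) a b :=
  continuous_subtype_val.matrix_elem a b

theorem integrable_haarUnitary {n : ℕ} {E : Type*} [NormedAddCommGroup E]
    [SecondCountableTopology E] {f : UGroup n → E} (hf : Continuous f) :
    Integrable f (haarUnitary n) :=
  hf.integrable_of_hasCompactSupport (HasCompactSupport.of_compactSpace f)

/-- Monomial matrices with entries of modulus one are unitary. -/
theorem exists_monomial {n : ℕ} (σ : Equiv.Perm (Bits n)) (u : Bits n → ℂ) (hu : ∀ i, ‖u i‖ = 1) :
    ∃ W : UGroup n, ∀ (V : UGroup n) (i x : Bits n),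
      ((W * V : UGroup n) : Matrix (Bits n) (Bits n) ℂ) i x =
        u i * (V : Matrix (Bits n) (Bits n) ℂ) (σ i) x := by
  refine ⟨⟨Matrix.of fun i j => if σ i = j then u i else 0, ?_⟩, fun V i x => ?_⟩
  · rw [Matrix.mem_unitaryGroup_iff]
    ext i j
    rw [Matrix.mul_apply, Matrix.one_apply]
    simp only [Matrix.of_apply, Matrix.star_apply, ite_mul, zero_mul, Finset.sum_ite_eq,
      Finset.mem_univ, if_true, EmbeddingLike.apply_eq_iff_eq]
    by_cases h : i = j
    · subst h
      simp only [if_true]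
      rw [← starRingEnd_apply, Complex.mul_conj', hu]
      simp
    · simp [h, Ne.symm h]
  · simp [Matrix.mul_apply]

/-- The columns of a unitary matrix are unit vectors. -/
theorem sum_normSq_column {n : ℕ} (V : UGroup n) (x : Bits n) :
    ∑ a, ‖(V : Matrix (Bits n) (Bits n) ℂ) a x‖ ^ 2 = 1 := by
  have h := congrFun (congrFun (Matrix.mem_unitaryGroup_iff'.1 V.2) x) x
  rw [Matrix.mul_apply, Matrix.one_apply_eq] at h
  simp only [Matrix.star_apply, ← starRingEnd_apply, Complex.conj_mul'] at h
  exact_mod_cast h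

theorem card_bits (n : ℕ) : Fintype.card (Bits n) = 2 ^ n := by simp

theorem integral_normSq_entry {n : ℕ} (a x : Bits n) :
    ∫ V, ‖(V : Matrix (Bits n) (Bits n) ℂ) a x‖ ^ 2 ∂(haarUnitary n) = ((2 : ℝ) ^ n)⁻¹ := by
  have heq : ∀ b : Bits n, ∫ V, ‖(V : Matrix (Bits n) (Bits n) ℂ) b x‖ ^ 2 ∂(haarUnitary n) =
      ∫ V, ‖(V : Matrix (Bits n) (Bits n) ℂ) a x‖ ^ 2 ∂(haarUnitary n) := by
    intro b
    obtain ⟨W, hW⟩ := exists_monomial (Equiv.swap a b) (fun _ => 1) (by simp)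
    rw [← integral_mul_left_eq_self
      (fun V : UGroup n => ‖(V : Matrix (Bits n) (Bits n) ℂ) b x‖ ^ 2) W]
    simp only [hW, Equiv.swap_apply_right, one_mul]
  have hsum : ∑ b : Bits n, ∫ V, ‖(V : Matrix (Bits n) (Bits n) ℂ) b x‖ ^ 2 ∂(haarUnitary n) =
      1 := by
    have hint : ∀ b : Bits n, Integrable
        (fun V : UGroup n => ‖(V : Matrix (Bits n) (Bits n) ℂ) b x‖ ^ 2) (haarUnitary n) :=
      fun b => integrable_haarUnitary ((continuous_entry b x).norm.fun_pow 2)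
    refine (integral_finsetSum Finset.univ fun b _ => hint b).symm.trans ?_
    simp only [sum_normSq_column]
    simp
  simp only [heq, Finset.sum_const, Finset.card_univ, card_bits, nsmul_eq_mul] at hsum
  push_cast at hsum
  exact eq_inv_of_mul_eq_one_right hsum

/-- By invariance under permutations, the mean of `|ψ_a|² |ψ_b|²` is the same for all `a ≠ b`, and
the `d (d - 1)` of them sum to at most `1`. -/
theorem integral_normSq_mul_normSq_entry_le {n : ℕ} {a b : Bits n} (hab : a ≠ b) (x : Bits n) :
    ∫ V, ‖(V : Matrix (Bits n) (Bits n) ℂ) a x‖ ^ 2 * ‖(V : Matrix (Bits n) (Bits n) ℂ) b x‖ ^ 2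
      ∂(haarUnitary n) ≤ 2 * (((2 : ℝ) ^ n)⁻¹) ^ 2 := by
  set I : Bits n × Bits n → ℝ := fun p =>
    ∫ V, ‖(V : Matrix (Bits n) (Bits n) ℂ) p.1 x‖ ^ 2 *
      ‖(V : Matrix (Bits n) (Bits n) ℂ) p.2 x‖ ^ 2 ∂(haarUnitary n) with hI
  have heq : ∀ p ∈ (Finset.univ : Finset (Bits n)).offDiag, I p = I (a, b) := by
    rintro ⟨c, e⟩ hp
    have hce : c ≠ e := by simpa using hp
    -- the permutation group is doubly transitive
    obtain ⟨σ, h1, h2⟩ : ∃ σ : Equiv.Perm (Bits n), σ c = a ∧ σ e = b := by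
      refine ⟨Equiv.swap (Equiv.swap c a e) b * Equiv.swap c a, ?_, by simp⟩
      have : a ≠ Equiv.swap c a e := by
        intro h
        have h' : Equiv.swap c a c = Equiv.swap c a e := by simpa using h
        exact hce ((Equiv.swap c a).injective h')
      simp [Equiv.swap_apply_of_ne_of_ne this hab]
    obtain ⟨W, hW⟩ := exists_monomial σ (fun _ => 1) (by simp)
    simp only [hI]
    rw [← integral_mul_left_eq_self (fun V : UGroup n =>
      ‖(V : Matrix (Bits n) (Bits n) ℂ) c x‖ ^ 2 * ‖(V : Matrix (Bits n) (Bits n) ℂ) e x‖ ^ 2) W]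
    simp only [hW, h1, h2, one_mul]
  have hint : ∀ p : Bits n × Bits n, Integrable (fun V : UGroup n =>
      ‖(V : Matrix (Bits n) (Bits n) ℂ) p.1 x‖ ^ 2 * ‖(V : Matrix (Bits n) (Bits n) ℂ) p.2 x‖ ^ 2)
      (haarUnitary n) := fun p =>
    integrable_haarUnitary
      (((continuous_entry p.1 x).norm.fun_pow 2).fun_mul ((continuous_entry p.2 x).norm.fun_pow 2))
  have hle : ∑ p ∈ (Finset.univ : Finset (Bits n)).offDiag, I p ≤ 1 := by
    calc ∑ p ∈ (Finset.univ : Finset (Bits n)).offDiag, I p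
        ≤ ∑ p : Bits n × Bits n, I p :=
          Finset.sum_le_sum_of_subset_of_nonneg (Finset.subset_univ _)
            fun p _ _ => integral_nonneg fun V => by positivity
      _ = 1 := by
          simp only [hI]
          refine (integral_finsetSum Finset.univ fun p _ => hint p).symm.trans ?_
          simp only [Fintype.sum_prod_type, ← Finset.mul_sum, sum_normSq_column, mul_one]
          simp
  rw [Finset.sum_congr rfl heq, Finset.sum_const, Finset.offDiag_card, Finset.card_univ,
    card_bits, nsmul_eq_mul, Nat.cast_sub (Nat.le_mul_self _)] at hle
  push_cast at hle
  change I (a, b) ≤ _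
  -- two distinct indices exist, so the dimension `d` is at least `2`, and `d ^ 2 / 2 ≤ d (d - 1)`
  have hd : (2 : ℝ) ≤ 2 ^ n := by
    rcases n with _ | n
    · exact absurd (Subsingleton.elim a b) hab
    · rw [pow_succ]
      linarith [one_le_pow₀ (M₀ := ℝ) (a := 2) (by norm_num) (n := n)]
  have h0 : 0 ≤ I (a, b) := integral_nonneg fun V => by positivity
  rw [inv_pow, ← div_eq_mul_inv, le_div_iff₀ (by positivity)]
  nlinarith [mul_nonneg (mul_nonneg h0 (by positivity : (0 : ℝ) ≤ 2 ^ n)) (sub_nonneg.2 hd)]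

/-- A function that is multiplied by a constant other than one under a translation has
integral zero. -/
theorem integral_eq_zero_of_translate {n : ℕ} {f : UGroup n → ℂ} (W : UGroup n) {c : ℂ}
    (hc : c ≠ 1) (h : ∀ V, f (W * V) = c * f V) : ∫ V, f V ∂(haarUnitary n) = 0 := by
  have h' := integral_mul_left_eq_self (μ := haarUnitary n) f W
  simp only [h, integral_const_mul] at h'
  have : (c - 1) * ∫ V, f V ∂(haarUnitary n) = 0 := by rw [sub_mul, h']; ring
  exact (mul_eq_zero.1 this).resolve_left (sub_ne_zero.2 hc)

theorem integral_normSq_sum_of_orthogonal {n : ℕ} {ι : Type*} (s : Finset ι)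
    (X : ι → UGroup n → ℂ) (hX : ∀ i, Continuous (X i))
    (h : ∀ i ∈ s, ∀ j ∈ s, i ≠ j → ∫ V, X i V * star (X j V) ∂(haarUnitary n) = 0) (m : ι → ℂ) :
    ∫ V, ‖∑ i ∈ s, m i * X i V‖ ^ 2 ∂(haarUnitary n) =
      ∑ i ∈ s, ‖m i‖ ^ 2 * ∫ V, ‖X i V‖ ^ 2 ∂(haarUnitary n) := by
  have key : ∀ V, ((‖∑ i ∈ s, m i * X i V‖ ^ 2 : ℝ) : ℂ) =
      ∑ i ∈ s, ∑ j ∈ s, m i * star (m j) * (X i V * star (X j V)) := by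
    intro V
    push_cast
    rw [← Complex.mul_conj', map_sum, Finset.sum_mul_sum]
    refine Finset.sum_congr rfl fun i _ => Finset.sum_congr rfl fun j _ => ?_
    simp only [map_mul, starRingEnd_apply]
    ring
  have hint : ∀ i j, Integrable (fun V => m i * star (m j) * (X i V * star (X j V)))
      (haarUnitary n) := fun i j =>
    integrable_haarUnitary (continuous_const.fun_mul ((hX i).fun_mul (hX j).star))
  apply Complex.ofReal_injective
  rw [← integral_complex_ofReal]
  simp only [key]
  rw [integral_finsetSum _ fun i _ => integrable_finsetSum _ fun j _ => hint i j]
  push_cast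
  refine Finset.sum_congr rfl fun i hi => ?_
  rw [integral_finsetSum _ fun j _ => hint i j, Finset.sum_eq_single_of_mem i hi]
  · rw [integral_const_mul, ← starRingEnd_apply, Complex.mul_conj']
    congr 1
    rw [← integral_complex_ofReal]
    refine integral_congr_ae (ae_of_all _ fun V => ?_)
    simp only [← starRingEnd_apply, Complex.mul_conj']
    push_cast
    rfl
  · intro j hj hji
    rw [integral_const_mul, h i hi j hj (Ne.symm hji), mul_zero]

/-- Some unitary multiplies the row `a` by `i`, on the left, and fixes all other rows. -/
theorem exists_phase {n : ℕ} (a : Bits n) :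
    ∃ W : UGroup n, ∀ (V : UGroup n) (i x : Bits n),
      ((W * V : UGroup n) : Matrix (Bits n) (Bits n) ℂ) i x =
        (if i = a then Complex.I else 1) * (V : Matrix (Bits n) (Bits n) ℂ) i x :=
  exists_monomial 1 (fun i => if i = a then Complex.I else 1)
    fun i => by by_cases h : i = a <;> simp [h]

theorem integral_normSq_dotProduct_column {n : ℕ} (k : Bits n → ℂ) (x : Bits n) :
    ∫ V, ‖∑ y, k y * star ((V : Matrix (Bits n) (Bits n) ℂ) y x)‖ ^ 2 ∂(haarUnitary n) =
      (∑ y, ‖k y‖ ^ 2) * ((2 : ℝ) ^ n)⁻¹ := by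
  refine (integral_normSq_sum_of_orthogonal Finset.univ
    (fun y (V : UGroup n) => star ((V : Matrix (Bits n) (Bits n) ℂ) y x))
    (fun y => (continuous_entry y x).star) ?_ k).trans ?_
  rotate_left
  · simp only [norm_star, integral_normSq_entry, Finset.sum_mul]
  · intro i _ j _ hij
    obtain ⟨W, hW⟩ := exists_phase i
    refine integral_eq_zero_of_translate W (c := -Complex.I) ?_ fun V => ?_
    · intro h
      simpa using congrArg Complex.re h
    · simp [hW, Ne.symm hij]
      ring

/-- Distinct off-diagonal terms are orthogonal, since some phase change of one coordinate multiplies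
their product by a constant other than one. -/
theorem integral_normSq_offDiag_le {n : ℕ} (M : Matrix (Bits n) (Bits n) ℂ) (x : Bits n) :
    ∫ V, ‖∑ p ∈ (Finset.univ : Finset (Bits n)).offDiag,
        M p.1 p.2 * (star ((V : Matrix (Bits n) (Bits n) ℂ) p.1 x) *
          (V : Matrix (Bits n) (Bits n) ℂ) p.2 x)‖ ^ 2 ∂(haarUnitary n) ≤
      (∑ a, ∑ b, ‖M a b‖ ^ 2) * (2 * (((2 : ℝ) ^ n)⁻¹) ^ 2) := by
  refine (integral_normSq_sum_of_orthogonal _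
    (fun (p : Bits n × Bits n) (V : UGroup n) => star ((V : Matrix (Bits n) (Bits n) ℂ) p.1 x) *
      (V : Matrix (Bits n) (Bits n) ℂ) p.2 x)
    (fun p => (continuous_entry p.1 x).star.fun_mul (continuous_entry p.2 x)) ?_
    fun p => M p.1 p.2).trans_le ?_
  rotate_left
  · calc _ ≤ ∑ p ∈ (Finset.univ : Finset (Bits n)).offDiag,
          ‖M p.1 p.2‖ ^ 2 * (2 * (((2 : ℝ) ^ n)⁻¹) ^ 2) := by
          refine Finset.sum_le_sum fun p hp => mul_le_mul_of_nonneg_left ?_ (by positivity)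
          simp only [norm_mul, norm_star, mul_pow]
          exact integral_normSq_mul_normSq_entry_le (by simpa using hp) x
      _ ≤ ∑ p : Bits n × Bits n, ‖M p.1 p.2‖ ^ 2 * (2 * (((2 : ℝ) ^ n)⁻¹) ^ 2) :=
        Finset.sum_le_sum_of_subset_of_nonneg (Finset.subset_univ _)
          fun p _ _ => by positivity
      _ = _ := by rw [← Finset.sum_mul, Fintype.sum_prod_type]
  · rintro ⟨a, b⟩ hp ⟨c, e⟩ hq hne
    have hab : a ≠ b := by simpa using hp
    have hce : c ≠ e := by simpa using hq
    by_cases hac : a = c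
    · subst hac
      have hbe : b ≠ e := fun h => hne (by rw [h])
      obtain ⟨W, hW⟩ := exists_phase b
      refine integral_eq_zero_of_translate W (c := Complex.I) ?_ fun V => ?_
      · intro h
        simpa using congrArg Complex.re h
      · simp [hW, hab, Ne.symm hbe]
        ring
    · obtain ⟨W, hW⟩ := exists_phase a
      -- the factor is `-i` or `-1`, depending on whether the coordinate occurs twice
      by_cases hae : a = e
      · subst hae
        refine integral_eq_zero_of_translate W (c := -1) (by norm_num) fun V => ?_
        simp only [hW, Ne.symm hab, Ne.symm hac, if_true, if_false, star_mul', star_star, one_mul]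
        have : star Complex.I = -Complex.I := Complex.conj_I
        rw [this]
        linear_combination
          star ((V : Matrix (Bits n) (Bits n) ℂ) a x) * (V : Matrix (Bits n) (Bits n) ℂ) b x *
          ((V : Matrix (Bits n) (Bits n) ℂ) c x * star ((V : Matrix (Bits n) (Bits n) ℂ) a x)) *
          Complex.I_sq
      · refine integral_eq_zero_of_translate W (c := -Complex.I) ?_ fun V => ?_
        · intro h
          simpa using congrArg Complex.re h
        · simp [hW, Ne.symm hab, Ne.symm hac, Ne.symm hae]
          ring

/-- The second moment of a quadratic form in a Haar-random unit vector is controlled by the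
diagonal of the form, up to a term that is small in high dimension. -/
theorem integral_normSq_quadratic_le {n : ℕ} (M : Matrix (Bits n) (Bits n) ℂ) (x : Bits n) :
    ∫ V, ‖∑ a, ∑ b, M a b * (star ((V : Matrix (Bits n) (Bits n) ℂ) a x) *
          (V : Matrix (Bits n) (Bits n) ℂ) b x)‖ ^ 2 ∂(haarUnitary n) ≤
      2 * ((∑ a, ‖M a a‖ ^ 2) * ((2 : ℝ) ^ n)⁻¹) +
        4 * ((∑ a, ∑ b, ‖M a b‖ ^ 2) * (((2 : ℝ) ^ n)⁻¹) ^ 2) := by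
  set X : Bits n → Bits n → UGroup n → ℂ := fun a b V =>
    star ((V : Matrix (Bits n) (Bits n) ℂ) a x) * (V : Matrix (Bits n) (Bits n) ℂ) b x with hX
  have hXc : ∀ a b, Continuous (X a b) := fun a b =>
    (continuous_entry a x).star.fun_mul (continuous_entry b x)
  set O : UGroup n → ℂ := fun V =>
    ∑ p ∈ (Finset.univ : Finset (Bits n)).offDiag, M p.1 p.2 * X p.1 p.2 V with hO
  have hOc : Continuous O := continuous_finsetSum _ fun p _ => continuous_const.fun_mul (hXc _ _)
  set D : UGroup n → ℝ := fun V =>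
    ∑ a, ‖(V : Matrix (Bits n) (Bits n) ℂ) a x‖ ^ 2 * ‖M a a‖ ^ 2 with hD
  have hDi : ∀ a ∈ Finset.univ, Integrable (fun V : UGroup n =>
      ‖(V : Matrix (Bits n) (Bits n) ℂ) a x‖ ^ 2 * ‖M a a‖ ^ 2) (haarUnitary n) := fun a _ =>
    integrable_haarUnitary (((continuous_entry a x).norm.fun_pow 2).fun_mul continuous_const)
  have hDi' : Integrable D (haarUnitary n) := integrable_finsetSum _ hDi
  have hOi : Integrable (fun V => ‖O V‖ ^ 2) (haarUnitary n) :=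
    integrable_haarUnitary (hOc.norm.fun_pow 2)
  have hpt : ∀ V, ‖∑ a, ∑ b, M a b * X a b V‖ ^ 2 ≤ 2 * D V + 2 * ‖O V‖ ^ 2 := by
    intro V
    have hsplit : ∑ a, ∑ b, M a b * X a b V = ∑ a, M a a * X a a V + O V := by
      rw [← Fintype.sum_prod_type' (fun a b => M a b * X a b V), ← Finset.univ_product_univ,
        ← Finset.diag_union_offDiag, Finset.sum_union (Finset.disjoint_diag_offDiag _),
        Finset.sum_diag]
    have hdiag : ‖∑ a, M a a * X a a V‖ ^ 2 ≤ D V := by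
      have h1 : ‖∑ a, M a a * X a a V‖ ≤
          ∑ a, ‖(V : Matrix (Bits n) (Bits n) ℂ) a x‖ ^ 2 * ‖M a a‖ := by
        refine (norm_sum_le _ _).trans (Finset.sum_le_sum fun a _ => le_of_eq ?_)
        simp only [hX, norm_mul, norm_star]
        ring
      have h2 := Finset.sum_sq_le_sum_mul_sum_of_sq_le_mul (Finset.univ : Finset (Bits n))
        (f := fun a => ‖(V : Matrix (Bits n) (Bits n) ℂ) a x‖ ^ 2)
        (g := fun a => ‖(V : Matrix (Bits n) (Bits n) ℂ) a x‖ ^ 2 * ‖M a a‖ ^ 2)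
        (r := fun a => ‖(V : Matrix (Bits n) (Bits n) ℂ) a x‖ ^ 2 * ‖M a a‖)
        (fun a _ => by positivity) (fun a _ => by positivity) (fun a _ => le_of_eq (by ring))
      rw [sum_normSq_column, one_mul] at h2
      exact (pow_le_pow_left₀ (norm_nonneg _) h1 2).trans h2
    rw [hsplit]
    have h3 := pow_le_pow_left₀ (norm_nonneg _) (norm_add_le (∑ a, M a a * X a a V) (O V)) 2
    nlinarith [sq_nonneg (‖∑ a, M a a * X a a V‖ - ‖O V‖)]
  calc _ ≤ ∫ V, 2 * D V + 2 * ‖O V‖ ^ 2 ∂(haarUnitary n) := by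
        refine integral_mono (integrable_haarUnitary ?_)
          ((hDi'.const_mul 2).add (hOi.const_mul 2)) hpt
        exact (continuous_finsetSum _ fun a _ => continuous_finsetSum _ fun b _ =>
          continuous_const.fun_mul (hXc a b)).norm.fun_pow 2
    _ = 2 * ((∑ a, ‖M a a‖ ^ 2) * ((2 : ℝ) ^ n)⁻¹) + 2 * ∫ V, ‖O V‖ ^ 2 ∂(haarUnitary n) := by
        rw [integral_add (hDi'.const_mul 2) (hOi.const_mul 2), integral_const_mul,
          integral_const_mul, integral_finsetSum _ hDi]
        simp only [integral_mul_const, integral_normSq_entry, ← Finset.mul_sum]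
        ring
    _ ≤ _ := by
        have := integral_normSq_offDiag_le M x
        linarith

/-! ### Overlaps of a quantum operation with a unitary -/

/-- `⟨φ|ρ|φ⟩` for the output `ρ` of the operation with Kraus operators `K` on the input `ψ`. -/
def overlap {n : ℕ} {ι : Type*} [Fintype ι] (K : ι → Matrix (Bits n) (Bits n) ℂ)
    (φ ψ : Bits n → ℂ) : ℝ := ∑ e, ‖star φ ⬝ᵥ (K e *ᵥ ψ)‖ ^ 2

/-- The mean squared fidelity of an operation with a unitary, over the computational basis
states. -/
def basisOverlap {n : ℕ} {ι : Type*} [Fintype ι] (K : ι → Matrix (Bits n) (Bits n) ℂ)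
    (U : UGroup n) : ℝ :=
  (∑ e, ∑ x, ‖((U : Matrix (Bits n) (Bits n) ℂ)ᴴ * K e) x x‖ ^ 2) * ((2 : ℝ) ^ n)⁻¹

/-- The operation with Kraus operators `K` preserves the trace of computational basis states. -/
def IsNormalized {n : ℕ} {ι : Type*} [Fintype ι] (K : ι → Matrix (Bits n) (Bits n) ℂ) : Prop :=
  ∀ x, ∑ e, ∑ y, ‖K e y x‖ ^ 2 = 1

theorem sum_normSq_conjTranspose_mulVec {n : ℕ} (U : UGroup n) (k : Bits n → ℂ) :
    ∑ a, ‖((U : Matrix (Bits n) (Bits n) ℂ)ᴴ *ᵥ k) a‖ ^ 2 = ∑ y, ‖k y‖ ^ 2 := by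
  have h : ∀ w : Bits n → ℂ, ((∑ a, ‖w a‖ ^ 2 : ℝ) : ℂ) = star w ⬝ᵥ w := by
    intro w
    push_cast
    simp only [dotProduct, Pi.star_apply, ← starRingEnd_apply, Complex.conj_mul']
  apply Complex.ofReal_injective
  rw [h, h, Matrix.star_mulVec, Matrix.conjTranspose_conjTranspose, ← Matrix.dotProduct_mulVec,
    Matrix.mulVec_mulVec, ← Matrix.star_eq_conjTranspose, Matrix.mem_unitaryGroup_iff.1 U.2,
    Matrix.one_mulVec]

/-- The overlap as a sum of squared quadratic forms in the input. -/
theorem overlap_mulVec {n : ℕ} {ι : Type*} [Fintype ι] (K : ι → Matrix (Bits n) (Bits n) ℂ)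
    (U : UGroup n) (ψ : Bits n → ℂ) :
    overlap K ((U : Matrix (Bits n) (Bits n) ℂ) *ᵥ ψ) ψ =
      ∑ e, ‖∑ a, ∑ b, ((U : Matrix (Bits n) (Bits n) ℂ)ᴴ * K e) a b * (star (ψ a) * ψ b)‖ ^ 2 := by
  refine Finset.sum_congr rfl fun e _ => ?_
  rw [Matrix.star_mulVec, ← Matrix.dotProduct_mulVec, Matrix.mulVec_mulVec]
  simp only [dotProduct, Matrix.mulVec, Pi.star_apply, Finset.mul_sum]
  congr 2
  refine Finset.sum_congr rfl fun a _ => Finset.sum_congr rfl fun b _ => ?_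
  ring

theorem continuous_basisOverlap {n : ℕ} {ι : Type*} [Fintype ι]
    (K : ι → Matrix (Bits n) (Bits n) ℂ) : Continuous (basisOverlap K) := by
  refine Continuous.fun_mul (continuous_finsetSum _ fun e _ => continuous_finsetSum _ fun x _ => ?_)
    continuous_const
  exact ((continuous_subtype_val.matrix_conjTranspose.matrix_mul
    continuous_const).matrix_elem x x).norm.fun_pow 2

theorem integral_basisOverlap {n : ℕ} {ι : Type*} [Fintype ι]
    {K : ι → Matrix (Bits n) (Bits n) ℂ} (hK : IsNormalized K) :
    ∫ V, basisOverlap K V ∂(haarUnitary n) = ((2 : ℝ) ^ n)⁻¹ := by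
  have hc : ∀ e x, Continuous fun V : UGroup n =>
      ‖((V : Matrix (Bits n) (Bits n) ℂ)ᴴ * K e) x x‖ ^ 2 := fun e x =>
    ((continuous_subtype_val.matrix_conjTranspose.matrix_mul
      continuous_const).matrix_elem x x).norm.fun_pow 2
  have h1 : ∀ e x, ∫ V, ‖((V : Matrix (Bits n) (Bits n) ℂ)ᴴ * K e) x x‖ ^ 2 ∂(haarUnitary n) =
      (∑ y, ‖K e y x‖ ^ 2) * ((2 : ℝ) ^ n)⁻¹ := by
    intro e x
    rw [← integral_normSq_dotProduct_column _ x]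
    simp only [Matrix.mul_apply, Matrix.conjTranspose_apply, mul_comm]
  simp only [basisOverlap]
  rw [integral_mul_const, integral_finsetSum _ fun e _ => integrable_finsetSum _ fun x _ =>
    integrable_haarUnitary (hc e x)]
  simp only [integral_finsetSum _ fun x _ => integrable_haarUnitary (hc _ x), h1]
  rw [Finset.sum_comm]
  simp only [← Finset.sum_mul, hK _]
  simp

theorem measurable_column (n : ℕ) : Measurable fun (V : UGroup n) (x : Bits n) =>
    (V : Matrix (Bits n) (Bits n) ℂ) x (fun _ => false) :=
  measurable_pi_lambda _ fun x => (continuous_entry x _).measurable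

instance isProbabilityMeasure_haarState (n : ℕ) : IsProbabilityMeasure (haarState n) :=
  Measure.isProbabilityMeasure_map (measurable_column n).aemeasurable

theorem integral_haarState {n : ℕ} {f : (Bits n → ℂ) → ℝ} (hf : Continuous f) :
    ∫ ψ, f ψ ∂(haarState n) =
      ∫ V : UGroup n, f (fun x => (V : Matrix (Bits n) (Bits n) ℂ) x fun _ => false)
        ∂(haarUnitary n) :=
  integral_map (measurable_column n).aemeasurable hf.measurable.aestronglyMeasurable

theorem integrable_haarState {n : ℕ} {f : (Bits n → ℂ) → ℝ} (hf : Continuous f) :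
    Integrable f (haarState n) :=
  (integrable_map_measure hf.measurable.aestronglyMeasurable (measurable_column n).aemeasurable).2
    (integrable_haarUnitary (hf.comp (continuous_pi fun x => continuous_entry x _)))

theorem continuous_overlap {n : ℕ} {ι : Type*} [Fintype ι]
    (K : ι → Matrix (Bits n) (Bits n) ℂ) :
    Continuous fun p : UGroup n × (Bits n → ℂ) =>
      overlap K ((p.1 : Matrix (Bits n) (Bits n) ℂ) *ᵥ p.2) p.2 := by
  refine continuous_finsetSum _ fun e _ => Continuous.fun_pow (Continuous.norm ?_) 2
  exact ((continuous_subtype_val.comp continuous_fst).matrix_mulVec continuous_snd).star.dotProduct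
    (continuous_const.matrix_mulVec continuous_snd)

theorem continuous_overlap_right {n : ℕ} {ι : Type*} [Fintype ι]
    (K : ι → Matrix (Bits n) (Bits n) ℂ) (U : UGroup n) :
    Continuous fun ψ : Bits n → ℂ =>
      overlap K ((U : Matrix (Bits n) (Bits n) ℂ) *ᵥ ψ) ψ := by
  refine continuous_finsetSum _ fun e _ => Continuous.fun_pow (Continuous.norm ?_) 2
  exact (continuous_const.matrix_mulVec continuous_id).star.dotProduct
    (continuous_const.matrix_mulVec continuous_id)

/-- The mean squared fidelity over Haar-random states is controlled by the mean over the
computational basis states. -/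
theorem integral_overlap_le {n : ℕ} {ι : Type*} [Fintype ι]
    {K : ι → Matrix (Bits n) (Bits n) ℂ} (hK : IsNormalized K) (U : UGroup n) :
    ∫ ψ, overlap K ((U : Matrix (Bits n) (Bits n) ℂ) *ᵥ ψ) ψ ∂(haarState n) ≤
      2 * basisOverlap K U + 4 * ((2 : ℝ) ^ n)⁻¹ := by
  have hcont := continuous_overlap_right K U
  have hfrob : ∑ e, ∑ a, ∑ b, ‖((U : Matrix (Bits n) (Bits n) ℂ)ᴴ * K e) a b‖ ^ 2 = 2 ^ n := by
    have h : ∀ e, ∑ a, ∑ b, ‖((U : Matrix (Bits n) (Bits n) ℂ)ᴴ * K e) a b‖ ^ 2 =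
        ∑ b, ∑ y, ‖K e y b‖ ^ 2 := by
      intro e
      rw [Finset.sum_comm]
      exact Finset.sum_congr rfl fun b _ => sum_normSq_conjTranspose_mulVec U fun y => K e y b
    simp only [h]
    rw [Finset.sum_comm]
    simp [hK _]
  rw [integral_haarState hcont]
  simp only [overlap_mulVec]
  rw [integral_finsetSum]
  · calc _ ≤ ∑ e, (2 * ((∑ a, ‖((U : Matrix (Bits n) (Bits n) ℂ)ᴴ * K e) a a‖ ^ 2) *
            ((2 : ℝ) ^ n)⁻¹) +
            4 * ((∑ a, ∑ b, ‖((U : Matrix (Bits n) (Bits n) ℂ)ᴴ * K e) a b‖ ^ 2) *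
            (((2 : ℝ) ^ n)⁻¹) ^ 2)) :=
          Finset.sum_le_sum fun e _ => integral_normSq_quadratic_le _ _
      _ = _ := by
          rw [Finset.sum_add_distrib, ← Finset.mul_sum, ← Finset.mul_sum, ← Finset.sum_mul,
            ← Finset.sum_mul, hfrob, basisOverlap]
          field_simp
  · intro e _
    exact integrable_haarUnitary ((continuous_finsetSum _ fun a _ => continuous_finsetSum _
      fun b _ => continuous_const.fun_mul ((continuous_entry a _).star.fun_mul
        (continuous_entry b _))).norm.fun_pow 2)

/-- Markov's inequality for the squared fidelity, for a fixed unitary. -/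
theorem measureReal_overlap_ge_le {n : ℕ} {ι : Type*} [Fintype ι]
    {K : ι → Matrix (Bits n) (Bits n) ℂ} (hK : IsNormalized K) (U : UGroup n) {δ : ℝ}
    (hδ : 0 < δ) :
    (haarState n).real {ψ | δ ^ 2 ≤ overlap K ((U : Matrix (Bits n) (Bits n) ℂ) *ᵥ ψ) ψ} ≤
      (δ ^ 2)⁻¹ * (2 * basisOverlap K U + 4 * ((2 : ℝ) ^ n)⁻¹) := by
  have hcont := continuous_overlap_right K U
  have hint : Integrable (fun ψ => overlap K ((U : Matrix (Bits n) (Bits n) ℂ) *ᵥ ψ) ψ)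
      (haarState n) := integrable_haarState hcont
  have h := mul_meas_ge_le_integral_of_nonneg
    (ae_of_all _ fun ψ => Finset.sum_nonneg fun e _ => by positivity) hint (δ ^ 2)
  rw [← div_eq_inv_mul, le_div_iff₀' (by positivity)]
  exact h.trans (integral_overlap_le hK U)

/-- No operation imitates a Haar-random unitary on a Haar-random state: the bound for a fixed
unitary is averaged. -/
theorem measureReal_prod_overlap_ge_le {n : ℕ} {ι : Type*} [Fintype ι]
    {K : ι → Matrix (Bits n) (Bits n) ℂ} (hK : IsNormalized K) {δ : ℝ} (hδ : 0 < δ) :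
    ((haarUnitary n).prod (haarState n)).real
        {p | δ ^ 2 ≤ overlap K ((p.1 : Matrix (Bits n) (Bits n) ℂ) *ᵥ p.2) p.2} ≤
      (δ ^ 2)⁻¹ * (6 * ((2 : ℝ) ^ n)⁻¹) := by
  have hmeas : MeasurableSet {p : UGroup n × (Bits n → ℂ) |
      δ ^ 2 ≤ overlap K ((p.1 : Matrix (Bits n) (Bits n) ℂ) *ᵥ p.2) p.2} :=
    measurableSet_le measurable_const (continuous_overlap K).measurable
  have hbi := (integrable_haarUnitary (continuous_basisOverlap K))
  have hb0 : ∀ V, 0 ≤ basisOverlap K V := fun V => by unfold basisOverlap; positivity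
  have hint : Integrable (fun V => (δ ^ 2)⁻¹ * (2 * basisOverlap K V + 4 * ((2 : ℝ) ^ n)⁻¹))
      (haarUnitary n) := ((hbi.const_mul 2).add (integrable_const _)).const_mul _
  have hval : ∫ V, (δ ^ 2)⁻¹ * (2 * basisOverlap K V + 4 * ((2 : ℝ) ^ n)⁻¹) ∂(haarUnitary n) =
      (δ ^ 2)⁻¹ * (6 * ((2 : ℝ) ^ n)⁻¹) := by
    rw [integral_const_mul, integral_add (hbi.const_mul 2) (integrable_const _),
      integral_const_mul, integral_basisOverlap hK]
    simp
    left
    ring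
  refine ENNReal.toReal_le_of_le_ofReal (by positivity) ?_
  rw [Measure.prod_apply hmeas, ← hval, ofReal_integral_eq_lintegral_ofReal hint
    (ae_of_all _ fun V => by have := hb0 V; positivity)]
  refine lintegral_mono fun V => ?_
  rw [← ofReal_measureReal]
  exact ENNReal.ofReal_le_ofReal (measureReal_overlap_ge_le hK V hδ)

/-! ### Kraus operators of a circuit -/

/-- The final state of a circuit on the input `|x⟩`. -/
def basisRun {n : ℕ} (A : Circuit) (x : Bits n) : State :=
  runCircuit (1 : UGroup n) A (Finsupp.single (regConfig 0 x) 1)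

/-- The basis states of the environment of the output register that occur when the circuit is run
on basis states; in such a state the output register itself holds zeros. -/
def envConfigs (n : ℕ) (A : Circuit) : Finset Config :=
  (Finset.univ : Finset (Bits n)).biUnion fun x =>
    (basisRun A x).support.image (writeReg 0 fun _ : Fin n => false)

/-- The Kraus operators of the operation that a circuit performs on the register in array `0`,
indexed by the basis states of the environment. -/
def kraus (n : ℕ) (A : Circuit) (e : envConfigs n A) : Matrix (Bits n) (Bits n) ℂ :=
  fun z x => basisRun A x (writeReg 0 z e)

theorem readReg_of_mem_envConfigs {n : ℕ} {A : Circuit} {e : Config} (he : e ∈ envConfigs n A) :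
    readReg n 0 e = fun _ => false := by
  simp only [envConfigs, Finset.mem_biUnion, Finset.mem_image] at he
  obtain ⟨x, -, s, -, rfl⟩ := he
  exact readReg_writeReg _ _

theorem writeReg_of_mem_envConfigs {n : ℕ} {A : Circuit} {e : Config} (he : e ∈ envConfigs n A) :
    writeReg 0 (fun _ : Fin n => false) e = e := by
  rw [← readReg_of_mem_envConfigs he, writeReg_readReg]

theorem regWire_notMem_of_mem_envConfigs {n : ℕ} {A : Circuit} {e : Config}
    (he : e ∈ envConfigs n A) (i : Fin n) : regWire 0 i ∉ e := by
  rw [← writeReg_of_mem_envConfigs he, regWire_mem_writeReg]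
  simp

theorem writeReg_mem_envConfigs {n : ℕ} {A : Circuit} {x : Bits n} {s : Config}
    (h : basisRun A x s ≠ 0) : writeReg 0 (fun _ : Fin n => false) s ∈ envConfigs n A :=
  Finset.mem_biUnion.2 ⟨x, Finset.mem_univ x,
    Finset.mem_image_of_mem _ (Finsupp.mem_support_iff.2 h)⟩

/-- Sums over configurations, split into the contents of the output register and the
environment. -/
theorem sum_support_filter_readReg {n : ℕ} {A : Circuit} {M : Type*} [AddCommMonoid M] {χ : State}
    (hχ : ∀ s ∈ χ.support, writeReg 0 (fun _ : Fin n => false) s ∈ envConfigs n A)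
    (g : Config → M) (hg : ∀ s ∉ χ.support, g s = 0) (y : Bits n) :
    ∑ s ∈ χ.support.filter (fun s => readReg n 0 s = y), g s =
      ∑ e : envConfigs n A, g (writeReg 0 y (e : Config)) := by
  rw [Finset.sum_coe_sort (envConfigs n A) fun e => g (writeReg 0 y e)]
  have hback : ∀ s, readReg n 0 s = y →
      writeReg 0 y (writeReg 0 (fun _ : Fin n => false) s) = s := by
    rintro s rfl
    rw [writeReg_writeReg, writeReg_readReg]
  refine Finset.sum_of_injOn (writeReg 0 fun _ : Fin n => false) ?_ ?_ ?_ ?_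
  · intro s hs t ht h
    rw [← hback s (Finset.mem_filter.1 hs).2, ← hback t (Finset.mem_filter.1 ht).2, h]
  · exact fun s hs => hχ s (Finset.mem_filter.1 hs).1
  · intro e he hne
    by_contra h
    refine hne ⟨writeReg 0 y e, ?_, ?_⟩
    · refine Finset.mem_coe.2 (Finset.mem_filter.2 ⟨?_, readReg_writeReg _ _⟩)
      by_contra h'
      exact h (hg _ h')
    · rw [writeReg_writeReg, writeReg_of_mem_envConfigs he]
  · intro s hs
    rw [hback s (Finset.mem_filter.1 hs).2]

theorem sum_support_eq {n : ℕ} {A : Circuit} {M : Type*} [AddCommMonoid M] {χ : State}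
    (hχ : ∀ s ∈ χ.support, writeReg 0 (fun _ : Fin n => false) s ∈ envConfigs n A)
    (g : Config → M) (hg : ∀ s ∉ χ.support, g s = 0) :
    ∑ s ∈ χ.support, g s =
      ∑ z : Bits n, ∑ e : envConfigs n A, g (writeReg 0 z (e : Config)) := by
  rw [← Finset.sum_fiberwise χ.support (readReg n 0) g]
  exact Finset.sum_congr rfl fun z _ => sum_support_filter_readReg hχ g hg z

theorem basisRun_support {n : ℕ} (A : Circuit) (x : Bits n) :
    ∀ s ∈ (basisRun A x).support, writeReg 0 (fun _ : Fin n => false) s ∈ envConfigs n A :=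
  fun _ hs => writeReg_mem_envConfigs (Finsupp.mem_support_iff.1 hs)

theorem basisRun_eq_sum {n : ℕ} (A : Circuit) (x : Bits n) :
    basisRun A x = ∑ z : Bits n, ∑ e : envConfigs n A,
      kraus n A e z x • Finsupp.single (writeReg 0 z (e : Config)) 1 := by
  conv_lhs => rw [← Finsupp.sum_single (basisRun A x)]
  rw [Finsupp.sum, sum_support_eq (basisRun_support A x)
    (fun s => Finsupp.single s (basisRun A x s))
    fun s hs => by simp [Finsupp.notMem_support_iff.1 hs]]
  simp [kraus]

/-- Trace preservation, from the fact that oracle-free circuits preserve the norm. -/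
theorem isNormalized_kraus {n : ℕ} {A : Circuit} (hA : OracleFree A) :
    IsNormalized (kraus n A) := by
  intro x
  have h := normSq_runCircuit (1 : UGroup n) A hA (Finsupp.single (regConfig 0 x) 1)
  rw [normSq, normSq] at h
  have h1 : ∑ s ∈ (Finsupp.single (regConfig 0 x) (1 : ℂ)).support,
      ‖Finsupp.single (regConfig 0 x) (1 : ℂ) s‖ ^ 2 = 1 := by
    rw [Finsupp.support_single _ one_ne_zero]
    simp
  rw [h1] at h
  rw [Finset.sum_comm, ← h]
  exact (sum_support_eq (basisRun_support A x) (fun s => ‖basisRun A x s‖ ^ 2)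
    fun s hs => by simp [Finsupp.notMem_support_iff.1 hs]).symm

theorem runCircuit_inputState_apply {n : ℕ} (A : Circuit) (ψ : Bits n → ℂ) (s : Config) :
    runCircuit (1 : UGroup n) A (inputState ψ) s = ∑ x, ψ x * basisRun A x s := by
  rw [inputState, runCircuit_sum]
  simp only [runCircuit_smul, Finsupp.finsetSum_apply, Finsupp.smul_apply, smul_eq_mul, basisRun]

/-- The fidelity of the output of a circuit, in terms of its Kraus operators. -/
theorem fidelity_outputState {n : ℕ} (A : Circuit) (ψ φ : Bits n → ℂ) :
    fidelity (outputState A ψ) φ = Real.sqrt (overlap (kraus n A) φ ψ) := by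
  set χ := runCircuit (1 : UGroup n) A (inputState ψ) with hχ
  have hsupp : ∀ s ∈ χ.support, writeReg 0 (fun _ : Fin n => false) s ∈ envConfigs n A := by
    intro s hs
    rw [Finsupp.mem_support_iff, hχ, runCircuit_inputState_apply] at hs
    obtain ⟨x, -, hx⟩ := Finset.exists_ne_zero_of_sum_ne_zero hs
    exact writeReg_mem_envConfigs (right_ne_zero_of_mul hx)
  have hw : ∀ (e : envConfigs n A) y, χ (writeReg 0 y (e : Config)) = (kraus n A e *ᵥ ψ) y := by
    intro e y
    rw [hχ, runCircuit_inputState_apply]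
    simp only [Matrix.mulVec, dotProduct, kraus, mul_comm]
  have hout : ∀ y z, outputState A ψ y z =
      ∑ e : envConfigs n A, (kraus n A e *ᵥ ψ) y * star ((kraus n A e *ᵥ ψ) z) := by
    intro y z
    refine (sum_support_filter_readReg hsupp (fun s => χ s * star (χ (writeReg 0 z s)))
      (fun s hs => by simp [Finsupp.notMem_support_iff.1 hs]) y).trans ?_
    simp only [writeReg_writeReg, hw]
  have key : star φ ⬝ᵥ (outputState A ψ *ᵥ φ) = ((overlap (kraus n A) φ ψ : ℝ) : ℂ) := by
    rw [overlap]
    push_cast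
    simp only [← Complex.mul_conj']
    have hR : ∀ e : envConfigs n A, (star φ ⬝ᵥ (kraus n A e *ᵥ ψ)) *
        (starRingEnd ℂ) (star φ ⬝ᵥ (kraus n A e *ᵥ ψ)) =
        ∑ y, ∑ z, star (φ y) * ((kraus n A e *ᵥ ψ) y * star ((kraus n A e *ᵥ ψ) z) * φ z) := by
      intro e
      rw [dotProduct, map_sum, Finset.sum_mul_sum]
      refine Finset.sum_congr rfl fun y _ => Finset.sum_congr rfl fun z _ => ?_
      simp only [Pi.star_apply, map_mul, starRingEnd_apply, star_star]
      ring
    simp only [hR]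
    rw [Finset.sum_comm, dotProduct]
    refine Finset.sum_congr rfl fun y _ => ?_
    rw [Finset.sum_comm, Matrix.mulVec, dotProduct, Finset.mul_sum]
    refine Finset.sum_congr rfl fun z _ => ?_
    rw [hout, Finset.sum_mul, Finset.mul_sum, Pi.star_apply]
  rw [fidelity, key, Complex.ofReal_re]

/-! ### Circuits of controlled-not and Toffoli gates -/

theorem mem_controlled_flip {P : Prop} [Decidable P] {t w : Wire} {s : Config} :
    w ∈ (if P then flipWire t s else s) ↔ if w = t ∧ P then w ∉ s else w ∈ s := by
  by_cases hP : P <;> by_cases hw : w = t <;> simp [hP, hw, mem_flipWire]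

/-- Exchange the values of two wires. -/
def swapWires (a b : Wire) (s : Config) : Config := s.map (Equiv.swap a b).toEmbedding

theorem mem_swapWires {a b w : Wire} {s : Config} :
    w ∈ swapWires a b s ↔ Equiv.swap a b w ∈ s := by
  rw [swapWires, Finset.mem_map_equiv, Equiv.symm_swap]

theorem swapWires_injective (a b : Wire) : Function.Injective (swapWires a b) :=
  Finset.map_injective _

theorem runCircuit_cnot_cnot_cnot {n : ℕ} (U : UGroup n) {a b : Wire} (hab : a ≠ b) (s : Config) :
    runCircuit U [.cnot a b, .cnot b a, .cnot a b] (Finsupp.single s 1) =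
      Finsupp.single (swapWires a b s) 1 := by
  simp only [runCircuit_cons, runCircuit_nil, applyGate_single, gateBasis, one_smul]
  congr 1
  ext w
  simp only [mem_swapWires, mem_controlled_flip, Equiv.swap_apply_def]
  by_cases h1 : w = a
  · subst h1
    by_cases h2 : w ∈ s <;> by_cases h3 : b ∈ s <;> simp [hab, hab.symm, h2, h3]
  · by_cases h4 : w = b
    · subst h4
      by_cases h2 : w ∈ s <;> by_cases h3 : a ∈ s <;> simp [hab, hab.symm, h2, h3]
    · simp [h1, h4]

/-- The three gates exchange two wires if the control is `1`, and cancel otherwise. -/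
theorem runCircuit_swapGates {n : ℕ} (U : UGroup n) (N i : ℕ) (s : Config) :
    runCircuit U (swapGates N i) (Finsupp.single s 1) =
      Finsupp.single (if wire (N + 2) 0 ∈ s then swapWires (wire (N + 1) i) (wire 0 i) s else s)
        1 := by
  have h1 : wire (N + 1) i ≠ wire 0 i := fun h => by simp [wire] at h
  have h2 : wire (N + 2) 0 ≠ wire (N + 1) i := fun h => by simp [wire] at h
  have h3 : wire (N + 2) 0 ≠ wire 0 i := fun h => by simp [wire] at h
  simp only [swapGates]
  generalize wire (N + 1) i = a at *
  generalize wire 0 i = b at *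
  generalize wire (N + 2) 0 = c at *
  simp only [runCircuit_cons, runCircuit_nil, applyGate_single, gateBasis, one_smul]
  congr 1
  ext w
  simp only [mem_controlled_flip]
  by_cases hc : c ∈ s
  · simp only [hc, if_true, mem_swapWires, Equiv.swap_apply_def]
    by_cases h4 : w = a
    · subst h4
      by_cases h5 : w ∈ s <;> by_cases h6 : b ∈ s <;> simp [h1, h1.symm, h2, h3, h5, h6]
    · by_cases h5 : w = b
      · subst h5
        by_cases h5 : w ∈ s <;> by_cases h6 : a ∈ s <;> simp [h1, h1.symm, h2, h3, h5, h6]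
      · simp [h4, h5]
  · by_cases h5 : w = b
    · subst h5
      by_cases h5 : w ∈ s <;> by_cases h6 : a ∈ s <;> simp [hc, h1, h1.symm, h2, h3, h5, h6]
    · by_cases h4 : w = a
      · subst h4
        simp [hc, h1, h3]
      · simp [hc, h4, h5]

/-- Exchange the first `m` wires of the arrays `0` and `N + 1`. -/
def swapRegs (N : ℕ) : ℕ → Config → Config
  | 0, s => s
  | m + 1, s => swapWires (wire (N + 1) m) (wire 0 m) (swapRegs N m s)

theorem wire_inj {r r' i j : ℕ} : wire r i = wire r' j ↔ r = r' ∧ i = j := by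
  simp [wire]

/-- Membership after the exchange, on the wires of the two registers and on all others. -/
theorem mem_swapRegs (N m : ℕ) (s : Config) :
    (∀ i < m, (wire 0 i ∈ swapRegs N m s ↔ wire (N + 1) i ∈ s) ∧
      (wire (N + 1) i ∈ swapRegs N m s ↔ wire 0 i ∈ s)) ∧
    ∀ w, (∀ i < m, w ≠ wire 0 i ∧ w ≠ wire (N + 1) i) → (w ∈ swapRegs N m s ↔ w ∈ s) := by
  induction m with
  | zero => simp [swapRegs]
  | succ m ih =>
    obtain ⟨ih₁, ih₂⟩ := ih
    simp only [swapRegs, mem_swapWires]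
    refine ⟨fun i hi => ?_, fun w hw => ?_⟩
    · rcases Nat.lt_succ_iff_lt_or_eq.1 hi with h | rfl
      · rw [Equiv.swap_apply_of_ne_of_ne, Equiv.swap_apply_of_ne_of_ne]
        · exact ih₁ i h
        all_goals rw [Ne, wire_inj]; omega
      · rw [Equiv.swap_apply_right, Equiv.swap_apply_left]
        constructor
        all_goals
          refine ih₂ _ fun j hj => ?_
          rw [Ne, wire_inj, Ne, wire_inj]
          omega
    · rw [Equiv.swap_apply_of_ne_of_ne (hw m (by omega)).2 (hw m (by omega)).1]
      exact ih₂ w fun i hi => hw i (by omega)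

theorem control_mem_swapRegs {N m : ℕ} {s : Config} :
    wire (N + 2) 0 ∈ swapRegs N m s ↔ wire (N + 2) 0 ∈ s := by
  refine (mem_swapRegs N m s).2 _ fun i _ => ?_
  rw [Ne, wire_inj, Ne, wire_inj]
  omega

theorem runCircuit_flatMap_swapGates {n : ℕ} (U : UGroup n) (N m : ℕ) (s : Config) :
    runCircuit U ((List.range m).flatMap (swapGates N)) (Finsupp.single s 1) =
      Finsupp.single (if wire (N + 2) 0 ∈ s then swapRegs N m s else s) 1 := by
  induction m with
  | zero => simp [swapRegs]
  | succ m ih =>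
    rw [List.range_succ, List.flatMap_append, runCircuit_append, ih]
    simp only [List.flatMap_cons, List.flatMap_nil, List.append_nil, runCircuit_swapGates]
    by_cases h : wire (N + 2) 0 ∈ s
    · simp [h, control_mem_swapRegs, swapRegs]
    · simp [h]

/-! ### The preparation of a random basis state -/

/-- The basis state that holds `x` in the arrays `N`, `0` and `N + 1`. -/
def prepConfig {m : ℕ} (N : ℕ) (x : Bits m) : Config :=
  regConfig N x ∪ (regConfig 0 x ∪ regConfig (N + 1) x)

/-- The amplitude `1 / √2`. -/
def invSqrtTwo : ℂ := ((Real.sqrt 2 : ℝ) : ℂ)⁻¹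

theorem invSqrtTwo_mul_self : invSqrtTwo * invSqrtTwo = 2⁻¹ := by
  rw [invSqrtTwo, ← mul_inv, ← Complex.ofReal_mul, Real.mul_self_sqrt (by norm_num)]
  norm_num

theorem norm_invSqrtTwo_sq : ‖invSqrtTwo‖ ^ 2 = 2⁻¹ := by
  rw [pow_two, ← norm_mul, invSqrtTwo_mul_self]
  norm_num

theorem applyGate_had_of_notMem {n : ℕ} (U : UGroup n) {q : Wire} {s : Config} (h : q ∉ s) :
    applyGate U (.had q) (Finsupp.single s 1) =
      invSqrtTwo • (Finsupp.single s 1 + Finsupp.single (insert q s) 1) := by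
  simp [gateBasis, h, invSqrtTwo]

theorem applyGate_had_insert {n : ℕ} (U : UGroup n) {q : Wire} {s : Config} (h : q ∉ s) :
    applyGate U (.had q) (Finsupp.single (insert q s) 1) =
      invSqrtTwo • (Finsupp.single s 1 - Finsupp.single (insert q s) 1) := by
  simp [gateBasis, h, invSqrtTwo, sub_eq_add_neg]

theorem flipWire_of_notMem {q : Wire} {s : Config} (h : q ∉ s) : flipWire q s = insert q s := by
  ext w
  rw [mem_flipWire, Finset.mem_insert]
  by_cases hw : w = q <;> simp [hw, h]

theorem runCircuit_prepGates {n : ℕ} (U : UGroup n) {N i : ℕ} (hN : 0 < N) {s : Config}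
    (hs : ∀ r, wire r i ∉ s) :
    runCircuit U (prepGates N i) (Finsupp.single s 1) =
      invSqrtTwo • (Finsupp.single s 1 +
        Finsupp.single (insert (wire N i) (insert (wire 0 i) (insert (wire (N + 1) i) s))) 1) := by
  have h1 : wire N i ≠ wire 0 i := fun h => by rw [wire_inj] at h; omega
  have h2 : wire (N + 1) i ≠ wire 0 i := fun h => by rw [wire_inj] at h; omega
  have h3 : wire N i ≠ wire (N + 1) i := fun h => by rw [wire_inj] at h; omega
  rw [prepGates, runCircuit_cons, applyGate_had_of_notMem U (hs N)]
  simp only [runCircuit_smul, runCircuit_add, runCircuit_cons, runCircuit_nil, applyGate_single,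
    gateBasis, one_smul]
  congr 2
  · simp [hs]
  · have e1 : flipWire (wire 0 i) (insert (wire N i) s) = insert (wire 0 i) (insert (wire N i) s) :=
      flipWire_of_notMem (by simp [hs, h1.symm])
    have e2 : flipWire (wire (N + 1) i) (insert (wire 0 i) (insert (wire N i) s)) =
        insert (wire (N + 1) i) (insert (wire 0 i) (insert (wire N i) s)) :=
      flipWire_of_notMem (by simp [hs, h2, h3.symm])
    simp only [Finset.mem_insert_self, Finset.mem_insert_of_mem, h1, h3, ne_eq, not_false_eq_true,
      and_self, if_true, e1, e2]
    congr 1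
    ext w
    simp only [Finset.mem_insert]
    tauto

theorem mem_regConfig {n r : ℕ} {x : Bits n} {w : Wire} :
    w ∈ regConfig r x ↔ ∃ i : Fin n, x i = true ∧ w = wire r i := by
  simp only [regConfig, Finset.mem_image, Finset.mem_filter, Finset.mem_univ, true_and, eq_comm]
  rfl

theorem regConfig_snoc {m : ℕ} (r : ℕ) (x : Bits m) (b : Bool) :
    regConfig r (Fin.snoc (α := fun _ => Bool) x b : Bits (m + 1)) =
      if b = true then insert (wire r m) (regConfig r x) else regConfig r x := by
  ext w
  have : w ∈ regConfig r (Fin.snoc (α := fun _ => Bool) x b : Bits (m + 1)) ↔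
      (w ∈ regConfig r x ∨ (b = true ∧ w = wire r m)) := by
    simp only [mem_regConfig]
    constructor
    · rintro ⟨i, hi, rfl⟩
      induction i using Fin.lastCases with
      | last => right; simpa using hi
      | cast i => left; exact ⟨i, by simpa using hi, by simp⟩
    · rintro (⟨i, hi, rfl⟩ | ⟨hb, rfl⟩)
      · exact ⟨i.castSucc, by simpa using hi, by simp⟩
      · exact ⟨Fin.last m, by simpa using hb, by simp⟩
  rw [this]
  by_cases hb : b = true <;> simp [hb, or_comm]

theorem runCircuit_flatMap_prepGates {n : ℕ} (U : UGroup n) {N : ℕ} (hN : 0 < N) (m : ℕ) :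
    runCircuit U ((List.range m).flatMap (prepGates N)) (Finsupp.single ∅ 1) =
      invSqrtTwo ^ m • ∑ x : Bits m, Finsupp.single (prepConfig N x) 1 := by
  induction m with
  | zero => simp [prepConfig, regConfig]
  | succ m ih =>
    rw [List.range_succ, List.flatMap_append, runCircuit_append, ih, runCircuit_smul,
      runCircuit_sum, pow_succ, mul_smul]
    congr 1
    rw [← (Fin.snocEquiv fun _ : Fin (m + 1) => Bool).sum_comp, Fintype.sum_prod_type,
      Fintype.sum_bool, ← Finset.sum_add_distrib, Finset.smul_sum]
    refine Finset.sum_congr rfl fun x _ => ?_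
    simp only [List.flatMap_cons, List.flatMap_nil, List.append_nil]
    rw [runCircuit_prepGates U hN, add_comm (Finsupp.single _ _)]
    · have h : ∀ r, regConfig r (Fin.snocEquiv (fun _ : Fin (m + 1) => Bool) (true, x)) =
          insert (wire r m) (regConfig r x) := fun r => (regConfig_snoc r x true).trans (if_pos rfl)
      have h' : ∀ r, regConfig r (Fin.snocEquiv (fun _ : Fin (m + 1) => Bool) (false, x)) =
          regConfig r x := fun r => (regConfig_snoc r x false).trans (if_neg (by simp))
      congr 3
      · simp only [prepConfig, h]
        ext w
        simp only [Finset.mem_insert, Finset.mem_union]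
        tauto
      · simp only [prepConfig, h']
    · intro r
      simp only [prepConfig, Finset.mem_union, mem_regConfig, wire_inj]
      have : ∀ i : Fin m, m ≠ i := fun i => i.2.ne'
      simp [this]

/-! ### The swap test -/

/-- The acceptance probability of a circuit whose final state is given as a superposition of
basis states, those with output `1` being distinct. -/
theorem acceptProb_of_eq_sum {n : ℕ} {U : UGroup n} {C : Circuit} {I : Type*} [Fintype I]
    {p q : I → ℂ} {P Q : I → Config} (hP : ∀ i, ((0, []) : Wire) ∉ P i)
    (hQ : ∀ i, ((0, []) : Wire) ∈ Q i) (hinj : Function.Injective Q)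
    (h : runCircuit U C (Finsupp.single ∅ 1) =
      ∑ i, p i • Finsupp.single (P i) 1 + ∑ i, q i • Finsupp.single (Q i) 1) :
    acceptProb U C = ∑ i, ‖q i‖ ^ 2 := by
  classical
  have hval : ∀ s, ((0, []) : Wire) ∈ s → runCircuit U C (Finsupp.single ∅ 1) s =
      ∑ i, if Q i = s then q i else 0 := by
    intro s hs
    have hP' : ∀ i, P i ≠ s := fun i h => hP i (h ▸ hs)
    rw [h, Finsupp.add_apply, Finsupp.finsetSum_apply, Finsupp.finsetSum_apply]
    simp [Finsupp.single_apply, hP']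
  have hvalQ : ∀ j, runCircuit U C (Finsupp.single ∅ 1) (Q j) = q j := by
    intro j
    rw [hval _ (hQ j)]
    simp [hinj.eq_iff]
  rw [acceptProb, Finset.sum_subset (s₂ := Finset.univ.image Q)]
  · rw [Finset.sum_image fun i _ j _ hij => hinj hij]
    simp only [hvalQ]
  · intro s hs
    rw [Finset.mem_filter, Finsupp.mem_support_iff] at hs
    obtain ⟨hne, hs⟩ := hs
    rw [hval s hs] at hne
    obtain ⟨i, -, hi⟩ := Finset.exists_ne_zero_of_sum_ne_zero hne
    exact Finset.mem_image.2 ⟨i, Finset.mem_univ i, by_contra fun h => hi (if_neg h)⟩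
  · intro s hs hns
    obtain ⟨i, -, rfl⟩ := Finset.mem_image.1 hs
    have : Q i ∉ (runCircuit U C (Finsupp.single ∅ 1)).support := fun h =>
      hns (Finset.mem_filter.2 ⟨h, hQ i⟩)
    simp [Finsupp.notMem_support_iff.1 this]

/-- The swap test, applied to a superposition of basis states on which exchanging the two
registers acts as a permutation `τ` of the index set. -/
theorem runCircuit_swapTest {n N : ℕ} (U : UGroup n) {I : Type*} [Fintype I] (a : I → ℂ)
    (J : I → Config) (τ : Equiv.Perm I) (hτ : Function.Involutive τ)
    (hc : ∀ i, wire (N + 2) 0 ∉ J i)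
    (hJ : ∀ i, swapRegs N n (insert (wire (N + 2) 0) (J i)) = insert (wire (N + 2) 0) (J (τ i))) :
    runCircuit U (swapTest N n) (∑ i, a i • Finsupp.single (J i) 1) =
      ∑ i, (2⁻¹ * (a i + a (τ i))) •
          Finsupp.single (swapWires (wire (N + 2) 0) (wire 0 0) (J i)) 1 +
        ∑ i, (2⁻¹ * (a i - a (τ i))) • Finsupp.single
          (swapWires (wire (N + 2) 0) (wire 0 0) (insert (wire (N + 2) 0) (J i))) 1 := by
  set c := wire (N + 2) 0 with hcdef
  have hne : c ≠ wire 0 0 := fun h => by rw [hcdef, wire_inj] at h; omega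
  set F : I → State := fun i => Finsupp.single (swapWires c (wire 0 0) (J i)) 1 with hF
  set G : I → State := fun i => Finsupp.single (swapWires c (wire 0 0) (insert c (J i))) 1 with hG
  have hstep : ∀ i, runCircuit U (swapTest N n) (Finsupp.single (J i) 1) =
      (2⁻¹ : ℂ) • (F i + G i + F (τ i) - G (τ i)) := by
    intro i
    rw [swapTest, ← hcdef, runCircuit_cons, applyGate_had_of_notMem U (hc i), runCircuit_append,
      runCircuit_smul, runCircuit_add, runCircuit_flatMap_swapGates, runCircuit_flatMap_swapGates,
      if_neg (hc i), if_pos (Finset.mem_insert_self _ _), hJ, runCircuit_cons, map_smul, map_add,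
      applyGate_had_of_notMem U (hc i), applyGate_had_insert U (hc _), ← smul_add, smul_smul,
      invSqrtTwo_mul_self, runCircuit_smul, sub_eq_add_neg, ← neg_one_smul ℂ]
    simp only [runCircuit_add, runCircuit_smul, runCircuit_cnot_cnot_cnot U hne, hF, hG]
    module
  have hflip : ∀ f : I → State, ∑ i, a i • f (τ i) = ∑ i, a (τ i) • f i := by
    intro f
    rw [← Equiv.sum_comp τ fun i => a i • f (τ i)]
    simp only [hτ _]
  have h1 : ∀ i, a i • (2⁻¹ : ℂ) • (F i + G i + F (τ i) - G (τ i)) =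
      (2⁻¹ : ℂ) • (a i • F i + a i • G i + a i • F (τ i) - a i • G (τ i)) := by
    intro i; module
  rw [runCircuit_sum]
  simp only [runCircuit_smul, hstep, h1]
  rw [← Finset.smul_sum, Finset.sum_sub_distrib, Finset.sum_add_distrib, Finset.sum_add_distrib,
    hflip F, hflip G, ← Finset.sum_add_distrib, ← Finset.sum_add_distrib, ← Finset.sum_sub_distrib,
    Finset.smul_sum, ← Finset.sum_add_distrib]
  exact Finset.sum_congr rfl fun i _ => by module

/-! ### The acceptance probability of the distinguisher -/

theorem configBelow_of_mem_envConfigs {n N : ℕ} (hN : 0 < N) {A : Circuit} (hA : OracleFree A)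
    (hAN : ∀ g ∈ A, ArraysBelow N g) {e : Config} (he : e ∈ envConfigs n A) : ConfigBelow N e := by
  simp only [envConfigs, Finset.mem_biUnion, Finset.mem_image] at he
  obtain ⟨x, -, s, hs, rfl⟩ := he
  have h := runCircuit_mem_supported (1 : UGroup n) A hA hAN
    (χ := Finsupp.single (regConfig 0 x) 1)
    (Finsupp.single_mem_supported ℂ _ fun w hw => by rw [fst_of_mem_regConfig hw]; exact hN)
  have hs' : ConfigBelow N s := (Finsupp.mem_supported ℂ _).1 h hs
  intro w hw
  by_cases hwr : w ∈ regWires n 0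
  · obtain ⟨i, rfl⟩ := mem_regWires.1 hwr
    exact hN
  · exact hs' w ((mem_writeReg_of_notMem hwr).1 hw)

/-- The index set of the basis states that occur in the swap test: the random string, the output
of the oracle, the output of the circuit, and the environment of the circuit. -/
abbrev TestIndex (n : ℕ) (A : Circuit) := (Bits n × envConfigs n A) × Bits n × Bits n

/-- The basis states that occur in the swap test. -/
def testConfig {n : ℕ} (N : ℕ) {A : Circuit} (i : TestIndex n A) : Config :=
  writeReg 0 i.2.2 (i.1.2 : Config) ∪ (regConfig N i.1.1 ∪ regConfig (N + 1) i.2.1)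

/-- Exchange the outputs of the oracle and of the circuit. -/
def testSwap (n : ℕ) (A : Circuit) : Equiv.Perm (TestIndex n A) :=
  (Equiv.refl _).prodCongr (Equiv.prodComm _ _)

section
variable {n N : ℕ} {A : Circuit}

theorem regWire_zero_mem_testConfig (hN : 0 < N) (t : TestIndex n A) (i : Fin n) :
    regWire 0 i ∈ testConfig N t ↔ t.2.2 i = true := by
  simp [testConfig, regWire_mem_writeReg, regWire_mem_regConfig, hN.ne]

theorem notMem_writeReg_of_le (hN : 0 < N) (hA : OracleFree A) (hAN : ∀ g ∈ A, ArraysBelow N g)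
    (t : TestIndex n A) {w : Wire} (hw : N ≤ w.1) :
    w ∉ writeReg 0 t.2.2 (t.1.2 : Config) := by
  rw [mem_writeReg_of_notMem]
  · exact fun h => absurd (configBelow_of_mem_envConfigs hN hA hAN t.1.2.2 w h) (not_lt.2 hw)
  · intro h
    obtain ⟨i, rfl⟩ := mem_regWires.1 h
    exact absurd hw (not_le.2 hN)

theorem regWire_oracle_mem_testConfig (hN : 0 < N) (hA : OracleFree A)
    (hAN : ∀ g ∈ A, ArraysBelow N g) (t : TestIndex n A) (i : Fin n) :
    regWire (N + 1) i ∈ testConfig N t ↔ t.2.1 i = true := by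
  have h := notMem_writeReg_of_le hN hA hAN t (w := regWire (N + 1) i) (Nat.le_succ N)
  simp [testConfig, h, regWire_mem_regConfig]

theorem regWire_random_mem_testConfig (hN : 0 < N) (hA : OracleFree A)
    (hAN : ∀ g ∈ A, ArraysBelow N g) (t : TestIndex n A) (i : Fin n) :
    regWire N i ∈ testConfig N t ↔ t.1.1 i = true := by
  have h := notMem_writeReg_of_le hN hA hAN t (w := regWire N i) le_rfl
  simp [testConfig, h, regWire_mem_regConfig]

theorem mem_testConfig_of_notMem {t : TestIndex n A} {w : Wire} (h0 : w ∉ regWires n 0)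
    (h1 : w ∉ regWires n (N + 1)) :
    w ∈ testConfig N t ↔ w ∈ (t.1.2 : Config) ∨ w ∈ regConfig N t.1.1 := by
  have h1' : w ∉ regConfig (N + 1) t.2.1 := fun h => h1 (regConfig_subset _ h)
  simp [testConfig, mem_writeReg_of_notMem h0, h1']

theorem control_notMem_testConfig (hN : 0 < N) (hA : OracleFree A)
    (hAN : ∀ g ∈ A, ArraysBelow N g) (t : TestIndex n A) : wire (N + 2) 0 ∉ testConfig N t := by
  have h := notMem_writeReg_of_le hN hA hAN t (w := wire (N + 2) 0) (by simp [wire])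
  simp only [testConfig, Finset.mem_union, h, false_or, not_or]
  constructor <;> exact fun h => by have := fst_of_mem_regConfig h; simp [wire] at this

theorem testConfig_injective (hN : 0 < N) (hA : OracleFree A) (hAN : ∀ g ∈ A, ArraysBelow N g) :
    Function.Injective (testConfig N : TestIndex n A → Config) := by
  intro t t' h
  have hbool : ∀ {b b' : Bool}, (b = true ↔ b' = true) → b = b' := Bool.eq_iff_iff.2
  have hz : t.2.2 = t'.2.2 := funext fun i => hbool <| by
    rw [← regWire_zero_mem_testConfig hN t, h, regWire_zero_mem_testConfig hN]
  have hy : t.2.1 = t'.2.1 := funext fun i => hbool <| by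
    rw [← regWire_oracle_mem_testConfig hN hA hAN t, h, regWire_oracle_mem_testConfig hN hA hAN]
  have hx : t.1.1 = t'.1.1 := funext fun i => hbool <| by
    rw [← regWire_random_mem_testConfig hN hA hAN t, h, regWire_random_mem_testConfig hN hA hAN]
  have hmem : ∀ (t : TestIndex n A) (w : Wire), w ∈ (t.1.2 : Config) ↔
      w ∈ testConfig N t ∧ w.1 < N ∧ w ∉ regWires n 0 := by
    intro t w
    by_cases h0 : w ∈ regWires n 0
    · obtain ⟨i, rfl⟩ := mem_regWires.1 h0
      simp [regWire_notMem_of_mem_envConfigs t.1.2.2 i, h0]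
    · have hb := configBelow_of_mem_envConfigs hN hA hAN t.1.2.2 w
      by_cases hw : w.1 < N
      · have h1 : w ∉ regWires n (N + 1) := fun h => by
          obtain ⟨i, rfl⟩ := mem_regWires.1 h
          simp [regWire] at hw
        have h2 : w ∉ regConfig N t.1.1 := fun h => by
          rw [fst_of_mem_regConfig h] at hw
          exact lt_irrefl _ hw
        simp [mem_testConfig_of_notMem h0 h1, h0, hw, h2]
      · exact ⟨fun h => absurd (hb h) hw, fun h => absurd h.2.1 hw⟩
  have he : t.1.2 = t'.1.2 := Subtype.ext <| Finset.ext fun w => by rw [hmem, hmem t', h]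
  exact Prod.ext (Prod.ext hx he) (Prod.ext hy hz)

theorem swapRegs_testConfig (hN : 0 < N) (hA : OracleFree A) (hAN : ∀ g ∈ A, ArraysBelow N g)
    (t : TestIndex n A) :
    swapRegs N n (insert (wire (N + 2) 0) (testConfig N t)) =
      insert (wire (N + 2) 0) (testConfig N (testSwap n A t)) := by
  obtain ⟨hreg, hoff⟩ := mem_swapRegs N n (insert (wire (N + 2) 0) (testConfig N t))
  have hins : ∀ {r i : ℕ} {s : Config}, r ≠ N + 2 →
      (wire r i ∈ insert (wire (N + 2) 0) s ↔ wire r i ∈ s) := fun hr => by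
    rw [Finset.mem_insert, or_iff_right fun h => hr (wire_inj.1 h).1]
  ext w
  by_cases h0 : w ∈ regWires n 0
  · obtain ⟨i, rfl⟩ := mem_regWires.1 h0
    exact (hreg i i.2).1.trans <| (hins (by omega)).trans <|
      (regWire_oracle_mem_testConfig hN hA hAN t i).trans <|
      (regWire_zero_mem_testConfig hN (testSwap n A t) i).symm.trans (hins (by omega)).symm
  · by_cases h1 : w ∈ regWires n (N + 1)
    · obtain ⟨i, rfl⟩ := mem_regWires.1 h1
      exact (hreg i i.2).2.trans <| (hins (by omega)).trans <|
        (regWire_zero_mem_testConfig hN t i).trans <|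
        (regWire_oracle_mem_testConfig hN hA hAN (testSwap n A t) i).symm.trans
          (hins (by omega)).symm
    · rw [hoff w fun i hi => ⟨fun h => h0 (mem_regWires.2 ⟨⟨i, hi⟩, h⟩),
        fun h => h1 (mem_regWires.2 ⟨⟨i, hi⟩, h⟩)⟩, Finset.mem_insert, Finset.mem_insert,
        mem_testConfig_of_notMem h0 h1, mem_testConfig_of_notMem h0 h1]
      rfl

/-- The amplitude of a basis state before the swap test. -/
def testAmplitude (U : UGroup n) (t : TestIndex n A) : ℂ :=
  invSqrtTwo ^ n * ((U : Matrix (Bits n) (Bits n) ℂ) t.2.1 t.1.1 * kraus n A t.1.2 t.2.2 t.1.1)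

theorem runCircuit_before_swapTest (hN : 0 < N) (hA : OracleFree A)
    (hAN : ∀ g ∈ A, ArraysBelow N g) (U : UGroup n) :
    runCircuit U ((List.range n).flatMap (prepGates N) ++ .oracle (N + 1) :: A)
        (Finsupp.single ∅ 1) =
      ∑ t : TestIndex n A, testAmplitude U t • Finsupp.single (testConfig N t) 1 := by
  have horacle : ∀ x : Bits n, applyGate U (.oracle (N + 1)) (Finsupp.single (prepConfig N x) 1) =
      ∑ y, (U : Matrix (Bits n) (Bits n) ℂ) y x •
        Finsupp.single (regConfig 0 x ∪ (regConfig N x ∪ regConfig (N + 1) y)) 1 := by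
    intro x
    have hread : readReg n (N + 1) (prepConfig N x) = x := by
      funext i
      simp [readReg, prepConfig, regWire_mem_regConfig]
    rw [applyGate_single, one_smul, gateBasis, hread]
    refine Finset.sum_congr rfl fun y _ => ?_
    congr 2
    ext w
    by_cases h : w ∈ regWires n (N + 1)
    · obtain ⟨i, rfl⟩ := mem_regWires.1 h
      rw [regWire_mem_writeReg]
      simp [regWire_mem_regConfig]
    · have h' : ∀ z : Bits n, w ∉ regConfig (N + 1) z := fun z hz => h (regConfig_subset _ hz)
      rw [mem_writeReg_of_notMem h]
      simp only [prepConfig, Finset.mem_union, h' _, or_false]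
      tauto
  have hrun : ∀ x y : Bits n, runCircuit U A
      (Finsupp.single (regConfig 0 x ∪ (regConfig N x ∪ regConfig (N + 1) y)) 1) =
      ∑ z : Bits n, ∑ e : envConfigs n A, kraus n A e z x • Finsupp.single
        (writeReg 0 z (e : Config) ∪ (regConfig N x ∪ regConfig (N + 1) y)) 1 := by
    intro x y
    have hT : ∀ w ∈ regConfig N x ∪ regConfig (N + 1) y, N ≤ w.1 := by
      intro w hw
      rcases Finset.mem_union.1 hw with h | h <;> rw [fst_of_mem_regConfig h]
      omega
    have h := runCircuit_mapDomain_union U (1 : UGroup n) hT A hA hAN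
      (Finsupp.single (regConfig 0 x) 1)
    rw [Finsupp.mapDomain_single] at h
    refine h.trans ?_
    change (basisRun A x).mapDomain _ = _
    rw [basisRun_eq_sum]
    simp only [Finsupp.mapDomain_finsetSum, Finsupp.mapDomain_smul, Finsupp.mapDomain_single]
  rw [runCircuit_append, runCircuit_flatMap_prepGates U hN, runCircuit_cons, map_smul, map_sum,
    runCircuit_smul, runCircuit_sum]
  simp only [horacle, runCircuit_sum, runCircuit_smul, hrun, Fintype.sum_prod_type,
    Finset.smul_sum, smul_smul]
  refine Finset.sum_congr rfl fun x _ => ?_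
  symm
  rw [Finset.sum_comm]
  refine Finset.sum_congr rfl fun y _ => ?_
  rw [Finset.sum_comm]
  refine Finset.sum_congr rfl fun z _ => Finset.sum_congr rfl fun e _ => ?_
  rw [testAmplitude]
  rfl

/-- Lagrange's identity: the squared norm of the antisymmetric part of `u ⊗ k`, which the swap test
accepts. -/
theorem sum_normSq_antisymmetrized {ι : Type*} [Fintype ι] (u k : ι → ℂ) :
    ∑ y, ∑ z, ‖u y * k z - u z * k y‖ ^ 2 =
      2 * ((∑ y, ‖u y‖ ^ 2) * ∑ z, ‖k z‖ ^ 2) - 2 * ‖∑ y, star (u y) * k y‖ ^ 2 := by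
  have hS : ((‖∑ y, star (u y) * k y‖ ^ 2 : ℝ) : ℂ) =
      ∑ y, ∑ z, (u y * k z) * (star (u z) * star (k y)) := by
    push_cast
    rw [← Complex.conj_mul', map_sum, Finset.sum_mul_sum]
    refine Finset.sum_congr rfl fun y _ => Finset.sum_congr rfl fun z _ => ?_
    simp only [map_mul, starRingEnd_apply, star_star]
    ring
  have hpt : ∀ y z, ((‖u y * k z - u z * k y‖ ^ 2 : ℝ) : ℂ) =
      (‖u y‖ ^ 2 : ℂ) * (‖k z‖ ^ 2 : ℂ) + (‖u z‖ ^ 2 : ℂ) * (‖k y‖ ^ 2 : ℂ) -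
        ((u y * k z) * (star (u z) * star (k y)) + (u z * k y) * (star (u y) * star (k z))) := by
    intro y z
    push_cast
    simp only [← Complex.mul_conj', map_sub, map_mul, starRingEnd_apply]
    ring
  apply Complex.ofReal_injective
  rw [Complex.ofReal_sub, Complex.ofReal_mul, Complex.ofReal_mul, Complex.ofReal_mul, hS,
    Complex.ofReal_sum]
  simp only [Complex.ofReal_sum, hpt, Finset.sum_sub_distrib, Finset.sum_add_distrib]
  rw [Finset.sum_comm (f := fun y z => (‖u z‖ ^ 2 : ℂ) * (‖k y‖ ^ 2 : ℂ)),
    Finset.sum_comm (f := fun y z => (u z * k y) * (star (u y) * star (k z))),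
    ← Finset.sum_mul_sum]
  push_cast
  ring

/-- The distinguisher measures how well the circuit imitates the oracle on random basis states. -/
theorem acceptProb_distinguisher (hN : 0 < N) (hA : OracleFree A)
    (hAN : ∀ g ∈ A, ArraysBelow N g) (U : UGroup n) :
    acceptProb U (distinguisher N n A) = 2⁻¹ - 2⁻¹ * basisOverlap (kraus n A) U := by
  have hsplit : runCircuit U (distinguisher N n A) (Finsupp.single ∅ 1) =
      runCircuit U (swapTest N n)
        (∑ t : TestIndex n A, testAmplitude U t • Finsupp.single (testConfig N t) 1) := by
    rw [distinguisher, ← List.cons_append, ← List.append_assoc, runCircuit_append,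
      runCircuit_before_swapTest hN hA hAN]
  have hrun := hsplit.trans <| runCircuit_swapTest U _ _ (testSwap n A) (fun _ => rfl)
    (control_notMem_testConfig hN hA hAN) (swapRegs_testConfig hN hA hAN)
  have hP : ∀ t : TestIndex n A,
      wire 0 0 ∉ swapWires (wire (N + 2) 0) (wire 0 0) (testConfig N t) := fun t => by
    rw [mem_swapWires, Equiv.swap_apply_right]
    exact control_notMem_testConfig hN hA hAN t
  have hQ : ∀ t : TestIndex n A, wire 0 0 ∈
      swapWires (wire (N + 2) 0) (wire 0 0) (insert (wire (N + 2) 0) (testConfig N t)) :=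
    fun t => by
      rw [mem_swapWires, Equiv.swap_apply_right]
      exact Finset.mem_insert_self _ _
  rw [acceptProb_of_eq_sum hP hQ ?_ hrun]
  rotate_left
  · intro t t' h
    have h' := swapWires_injective _ _ h
    refine testConfig_injective hN hA hAN ?_
    rw [← Finset.erase_insert (control_notMem_testConfig hN hA hAN t), h',
      Finset.erase_insert (control_notMem_testConfig hN hA hAN t')]
  have hterm : ∀ t : TestIndex n A,
      ‖2⁻¹ * (testAmplitude U t - testAmplitude U (testSwap n A t))‖ ^ 2 =
      4⁻¹ * ((2 : ℝ) ^ n)⁻¹ * ‖(U : Matrix (Bits n) (Bits n) ℂ) t.2.1 t.1.1 *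
          kraus n A t.1.2 t.2.2 t.1.1 - (U : Matrix (Bits n) (Bits n) ℂ) t.2.2 t.1.1 *
          kraus n A t.1.2 t.2.1 t.1.1‖ ^ 2 := by
    intro t
    have h : testAmplitude U (testSwap n A t) = invSqrtTwo ^ n *
      ((U : Matrix (Bits n) (Bits n) ℂ) t.2.2 t.1.1 * kraus n A t.1.2 t.2.1 t.1.1) := rfl
    rw [h, testAmplitude, ← mul_sub, norm_mul, norm_mul, mul_pow, mul_pow, norm_pow, ← pow_mul,
      mul_comm n 2, pow_mul, norm_invSqrtTwo_sq, inv_pow]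
    norm_num
    ring
  have hdot : ∀ (e : envConfigs n A) (x : Bits n),
      ∑ y, star ((U : Matrix (Bits n) (Bits n) ℂ) y x) * kraus n A e y x =
        ((U : Matrix (Bits n) (Bits n) ℂ)ᴴ * kraus n A e) x x := fun e x => by
    simp [Matrix.mul_apply]
  simp only [hterm, ← Finset.mul_sum]
  simp only [Fintype.sum_prod_type]
  have hlag : ∀ (e : envConfigs n A) (x : Bits n), _ := fun e x =>
    sum_normSq_antisymmetrized (fun y => (U : Matrix (Bits n) (Bits n) ℂ) y x)
      (fun y => kraus n A e y x)
  simp only [hlag, sum_normSq_column, one_mul, hdot, Finset.sum_sub_distrib, ← Finset.mul_sum,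
    isNormalized_kraus hA _]
  rw [basisOverlap, Finset.sum_comm]
  simp only [Finset.sum_const, Finset.card_univ, card_bits, nsmul_eq_mul]
  push_cast
  field_simp
  ring

end

/-! ### Estimation probabilities -/

theorem estimates_iff {n : ℕ} (A : Circuit) {δ : ℝ} (hδ : 0 < δ) (U : UGroup n) (ψ : Bits n → ℂ) :
    Estimates A δ U ψ ↔
      δ ^ 2 ≤ overlap (kraus n A) ((U : Matrix (Bits n) (Bits n) ℂ) *ᵥ ψ) ψ := by
  rw [Estimates, fidelity_outputState, Real.le_sqrt' hδ]

theorem keyAverage_mono {K : Finset (List Bool)} {f g : List Bool → ℝ} (h : ∀ k, f k ≤ g k) :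
    keyAverage K f ≤ keyAverage K g :=
  div_le_div_of_nonneg_right (Finset.sum_le_sum fun k _ => h k) (Nat.cast_nonneg _)

theorem keyAverage_affine {K : Finset (List Bool)} (hK : K.Nonempty) (a b : ℝ)
    (f : List Bool → ℝ) : keyAverage K (fun k => a + b * f k) = a + b * keyAverage K f := by
  have : (K.card : ℝ) ≠ 0 := by exact_mod_cast hK.card_pos.ne'
  rw [keyAverage, keyAverage, Finset.sum_add_distrib, ← Finset.mul_sum, Finset.sum_const,
    nsmul_eq_mul]
  field_simp

/-- The difference of the estimation probabilities is bounded by the advantage of the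
distinguisher and the inverse dimension. -/
theorem abs_estimates_sub_le {n N : ℕ} (hN : 0 < N) {A : Circuit} (hA : OracleFree A)
    (hAN : ∀ g ∈ A, ArraysBelow N g) {K : Finset (List Bool)} (hK : K.Nonempty)
    (U : List Bool → UGroup n) {δ : ℝ} (hδ : 0 < δ) :
    |keyAverage K (fun k => (haarState n).real {ψ | Estimates A δ (U k) ψ}) -
        ((haarUnitary n).prod (haarState n)).real {x | Estimates A δ x.1 x.2}| ≤
      (δ ^ 2)⁻¹ * (4 * |keyAverage K (fun k => acceptProb (U k) (distinguisher N n A)) -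
        ∫ V, acceptProb V (distinguisher N n A) ∂(haarUnitary n)| + 6 * ((2 : ℝ) ^ n)⁻¹) := by
  have hnorm := isNormalized_kraus (n := n) hA
  simp only [estimates_iff A hδ, acceptProb_distinguisher hN hA hAN]
  set b : List Bool → ℝ := fun k => basisOverlap (kraus n A) (U k) with hb
  have hkey : keyAverage K (fun k => 2⁻¹ - 2⁻¹ * basisOverlap (kraus n A) (U k)) =
      2⁻¹ - 2⁻¹ * keyAverage K b := by
    have := keyAverage_affine hK 2⁻¹ (-2⁻¹) b
    simp only [neg_mul, ← sub_eq_add_neg] at this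
    exact this
  have hint : ∫ V, (2⁻¹ - 2⁻¹ * basisOverlap (kraus n A) V) ∂(haarUnitary n) =
      2⁻¹ - 2⁻¹ * ((2 : ℝ) ^ n)⁻¹ := by
    rw [integral_sub (integrable_const _)
      ((integrable_haarUnitary (continuous_basisOverlap _)).const_mul _), integral_const_mul,
      integral_basisOverlap hnorm]
    simp
  rw [hkey, hint]
  have h1 : keyAverage K (fun k => (haarState n).real {ψ | δ ^ 2 ≤
      overlap (kraus n A) ((U k : Matrix (Bits n) (Bits n) ℂ) *ᵥ ψ) ψ}) ≤
      (δ ^ 2)⁻¹ * (4 * ((2 : ℝ) ^ n)⁻¹ + 2 * keyAverage K b) := by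
    have hle := keyAverage_mono (K := K) fun k => measureReal_overlap_ge_le hnorm (U k) hδ
    refine hle.trans (le_of_eq ?_)
    have := keyAverage_affine hK ((δ ^ 2)⁻¹ * (4 * ((2 : ℝ) ^ n)⁻¹)) ((δ ^ 2)⁻¹ * 2) b
    rw [mul_add, ← mul_assoc _ 2, ← this]
    congr 1
    funext k
    simp only [hb]
    ring
  have h0 : 0 ≤ keyAverage K (fun k => (haarState n).real {ψ | δ ^ 2 ≤
      overlap (kraus n A) ((U k : Matrix (Bits n) (Bits n) ℂ) *ᵥ ψ) ψ}) :=
    div_nonneg (Finset.sum_nonneg fun k _ => measureReal_nonneg) (Nat.cast_nonneg _)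
  have h2 := measureReal_prod_overlap_ge_le hnorm hδ
  have hpos : 0 < (δ ^ 2)⁻¹ := by positivity
  have hdiff : keyAverage K b ≤ ((2 : ℝ) ^ n)⁻¹ +
      2 * |2⁻¹ - 2⁻¹ * keyAverage K b - (2⁻¹ - 2⁻¹ * ((2 : ℝ) ^ n)⁻¹)| := by
    have := neg_abs_le (2⁻¹ - 2⁻¹ * keyAverage K b - (2⁻¹ - 2⁻¹ * ((2 : ℝ) ^ n)⁻¹))
    linarith
  have hd : (0 : ℝ) ≤ ((2 : ℝ) ^ n)⁻¹ := by positivity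
  rw [abs_le]
  constructor
  · have h3 : (δ ^ 2)⁻¹ * (6 * ((2 : ℝ) ^ n)⁻¹) ≤ (δ ^ 2)⁻¹ * (4 * |2⁻¹ - 2⁻¹ * keyAverage K b -
        (2⁻¹ - 2⁻¹ * ((2 : ℝ) ^ n)⁻¹)| + 6 * ((2 : ℝ) ^ n)⁻¹) :=
      mul_le_mul_of_nonneg_left (by linarith [abs_nonneg (2⁻¹ - 2⁻¹ * keyAverage K b -
        (2⁻¹ - 2⁻¹ * ((2 : ℝ) ^ n)⁻¹))]) hpos.le
    linarith
  · refine (sub_le_self _ measureReal_nonneg).trans (h1.trans ?_)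
    exact mul_le_mul_of_nonneg_left (by linarith) hpos.le

/-- The factor `δ⁻²` of Markov's inequality is polynomially bounded, so it does not affect
negligibility. -/
theorem isUnknownUnitary_of_pseudorandom {n : ℕ → ℕ} {K : ℕ → Finset (List Bool)}
    {U : (lam : ℕ) → List Bool → UGroup (n lam)} (hn : PolyBounded n)
    (hd : Negligible fun lam => ((2 : ℝ) ^ n lam)⁻¹) (hK : ∀ lam, (K lam).Nonempty)
    (hU : Pseudorandom n K U) : IsUnknownUnitary n K U := by
  intro A hA hfree δ hδ
  obtain ⟨N, hN, hAN, hD⟩ := hA.distinguisher hn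
  obtain ⟨c, hc⟩ := hδ
  have hneg := ((hU _ hD).const_mul 4).add (hd.const_mul 6)
  refine (hneg.param_pow_mul (2 * c)).trans_eventually_abs_le ?_
  filter_upwards [hc, eventually_gt_atTop 0] with lam hlam hpos
  have hpos' : (0 : ℝ) < (lam : ℝ) ^ c := by positivity
  have hδpos : 0 < δ lam := lt_of_lt_of_le (inv_pos.2 hpos') hlam
  have h := abs_estimates_sub_le (by omega) (hfree lam) (hAN lam) (hK lam) (U lam) hδpos
  simp only [Function.comp_apply, abs_abs, Pi.mul_apply, Pi.pow_apply, Pi.add_apply]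
  refine (h.trans ?_).trans (le_abs_self _)
  have hinv : (δ lam ^ 2)⁻¹ ≤ (lam : ℝ) ^ (2 * c) := by
    rw [mul_comm, pow_mul, inv_le_comm₀ (by positivity) (by positivity), ← inv_pow]
    exact pow_le_pow_left₀ (by positivity) hlam 2
  exact mul_le_mul_of_nonneg_right hinv (by positivity)

end QPT

end

theorem mainTheorem2 (n : ℕ → ℕ) (K : ℕ → Finset (List Bool))
    (U : (lam : ℕ) → List Bool → QPT.UGroup (n lam))
    (hn : QPT.PolyBounded n)
    (hd : QPT.Negligible fun lam => ((2 : ℝ) ^ n lam)⁻¹)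
    (hK : ∀ lam, (K lam).Nonempty)
    (hU : QPT.IsPRU n K U) :
    QPT.IsUnknownUnitary n K U :=
  QPT.isUnknownUnitary_of_pseudorandom hn hd hK hU.pseudorandom
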